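/- Let $K$ be a field and $S=K[x_1,\ldots,x_n]$, and order the monomials of $S$ lexicographically with $x_1>x_2>\cdots>x_n$. Let $u=x_1x_i$ with $2\le i\le n$ and $v=x_jx_k$ with $2\le j<k\le n$. Let $I\subset S$ be the ideal generated by $L(u,v)$, the set of all squarefree monomials $w$ of degree $2$ with $u\ge_{\mathrm{lex}} w\ge_{\mathrm{lex}} v$, and assume that $v>_{\mathrm{lex}}x_{i-1}x_n$. Write $\operatorname{depth}(S/I)$ for the maximal length of an $S/I$-regular sequence contained in $(x_1,\ldots,x_n)$. (a) If $j\ge 3$, then $\operatorname{depth}(S/I)=2$. (b) If $j=2$ and $k\ge i$, then $\operatorname{depth}(S/I)=2$. (c) If $j=2$ and $i>k$, then $\operatorname{depth}(S/I)=i+1-k$. Moreover, in this case the Taylor complex on the minimal monomial generators of $I$ (in any order) is a minimal free resolution of $S/I$, that is, it is a free resolution all of whose differentials have image contained in $(x_1,\ldots,x_n)$ times their target; and $\operatorname{proj\,dim}_S(S/I)$ equals the number of minimal monomial generators of $I$, which is $n+k-i-1$. -/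

import Mathlib

open MvPolynomial

/-- The exponent vector of the squarefree monomial `x_a x_b` of `K[x_1, …, x_n]`, for
`1 ≤ a < b ≤ n`. The variables of the polynomial ring are indexed by `Fin n`, so the variable
`x_a` of the usual notation is the one with index `a - 1`. -/
noncomputable def edge (n a b : ℕ) : Fin n →₀ ℕ :=
  Finsupp.equivFunOnFinite.symm fun c => if (c : ℕ) + 1 = a ∨ (c : ℕ) + 1 = b then 1 else 0

/-- The lexsegment set `L(u, v)`: the squarefree monomials `w` of degree two (given by their
exponent vectors) with `u ≥_lex w ≥_lex v`. The order `toLex` on exponent vectors is decided at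
the first coordinate where they differ, so this is the lexicographic order with
`x_1 > x_2 > … > x_n`. -/
def lexsegment {n : ℕ} (u v : Fin n →₀ ℕ) : Set (Fin n →₀ ℕ) :=
  {w | (∀ c, w c ≤ 1) ∧ w.degree = 2 ∧ toLex v ≤ toLex w ∧ toLex w ≤ toLex u}

/-- The lexsegment edge ideal `(L(u, v))` of `K[x_1, …, x_n]`. -/
noncomputable def lexsegmentEdgeIdeal (K : Type*) [Field K] {n : ℕ} (u v : Fin n →₀ ℕ) :
    Ideal (MvPolynomial (Fin n) K) :=
  Ideal.span ((fun w => monomial w (1 : K)) '' lexsegment u v)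

/-- The depth of a module `M` over `K[x_1, …, x_n]`: the supremum of the lengths of `M`-regular
sequences in the maximal ideal `(x_1, …, x_n)`. -/
noncomputable def polyDepth (K : Type*) [Field K] (n : ℕ) (M : Type*) [AddCommGroup M]
    [Module (MvPolynomial (Fin n) K) M] : ℕ∞ :=
  ⨆ rs : {rs : List (MvPolynomial (Fin n) K) //
      (∀ f ∈ rs, f ∈ idealOfVars (Fin n) K) ∧ RingTheory.Sequence.IsRegular M rs},
    (rs.1.length : ℕ∞)

/-- The minimal monomial generators of a monomial ideal `I` (given by their exponent vectors):
the monomials in `I` that are minimal with respect to divisibility. -/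
def minimalMonomialGenerators {K : Type*} [Field K] {n : ℕ}
    (I : Ideal (MvPolynomial (Fin n) K)) : Set (Fin n →₀ ℕ) :=
  {w | Minimal (fun w' => monomial w' (1 : K) ∈ I) w}

/-- The `p`-th module of the Taylor complex of `r` monomials: the free module with one basis
element `e_s` for every `p`-element subset `s` of the index set. -/
abbrev TaylorModule (K : Type*) [Field K] (n r p : ℕ) : Type _ :=
  {s : Finset (Fin r) // s.card = p} →₀ MvPolynomial (Fin n) K

/-- The differential of the Taylor complex of the monomials with exponent vectors `m`:
`e_s ↦ ∑_{a ∈ s} (-1)^{#{b ∈ s : b < a}} (lcm(s) / lcm(s \ {a})) e_{s \ {a}}`,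
where `lcm(s)` is the least common multiple of the monomials with index in `s`. -/
noncomputable def taylorD (K : Type*) [Field K] {n r : ℕ} (m : Fin r → Fin n →₀ ℕ) (p : ℕ) :
    TaylorModule K n r (p + 1) →ₗ[MvPolynomial (Fin n) K] TaylorModule K n r p :=
  Finsupp.linearCombination (MvPolynomial (Fin n) K) fun s =>
    ∑ a ∈ s.1.attach,
      Finsupp.single
        (⟨s.1.erase a.1, by rw [Finset.card_erase_of_mem a.2, s.2, Nat.add_sub_cancel]⟩ :
          {t : Finset (Fin r) // t.card = p})
        ((-1) ^ (s.1.filter (· < a.1)).card *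
          monomial (s.1.sup m - (s.1.erase a.1).sup m) (1 : K))

/-- The augmentation of the Taylor complex onto `S / I`, sending `e_∅` to the class of `1`. -/
noncomputable def taylorAugmentation {K : Type*} [Field K] {n : ℕ} (r : ℕ)
    (I : Ideal (MvPolynomial (Fin n) K)) :
    TaylorModule K n r 0 →ₗ[MvPolynomial (Fin n) K] MvPolynomial (Fin n) K ⧸ I :=
  Submodule.mkQ I ∘ₗ Finsupp.lapply ⟨∅, Finset.card_empty⟩

/-- `⋯ → F 2 → F 1 → F 0 → M → 0` is a minimal free resolution of `M` with respect to the
ideal `𝔪`: it is exact, its terms are free of finite rank, and the image of every differential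
`F (p + 1) → F p` lies in `𝔪 F p`. -/
structure IsMinimalFreeResolution {S : Type*} [CommRing S] (𝔪 : Ideal S)
    {M : Type*} [AddCommGroup M] [Module S M]
    (F : ℕ → Type*) [∀ p, AddCommGroup (F p)] [∀ p, Module S (F p)]
    (d : ∀ p, F (p + 1) →ₗ[S] F p) (ε : F 0 →ₗ[S] M) : Prop where
  free : ∀ p, Module.Free S (F p)
  finite : ∀ p, Module.Finite S (F p)
  surjective : Function.Surjective ε
  exact_zero : Function.Exact (d 0) ε
  exact_succ : ∀ p, Function.Exact (d (p + 1)) (d p)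
  minimal : ∀ p, LinearMap.range (d p) ≤ 𝔪 • (⊤ : Submodule S (F p))

/-! The ideal `I` is the edge ideal of a graph on `1, …, n`, so it is the Stanley–Reisner ideal of
the complex `Δ` of independent sets. The hypothesis on `v` says `j + 1 < i`, or `j + 1 = i` and `k <
n`; in particular `i ≥ 3`, so `{1, 2}` is independent. Let `V` be the set of `c` with `k < c < i` if
`j = 2`, and empty otherwise. All three depth values are `|V| + 2`.

Upper bound: `{1, 2} ∪ V` is a facet `F` of `Δ`. The product of its variables is killed modulo `I`
by every variable outside `F`, and a regular sequence is no longer than the Krull dimension of the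
quotient by such an annihilating ideal, here `|F|` (`length_le_card_facet`).

Lower bound: the elements of `V` are isolated vertices of the graph, hence cone points of `Δ`, and
their variables form a regular sequence. What remains is a connected complex with at least two
vertices; its Stanley–Reisner ring admits a regular sequence of length two, by a coefficient
comparison that kills the first Koszul cohomology (`exists_isWeaklyRegular_pair`).

For `j = 2` and `k < i` the larger endpoint of an edge lies on no other edge. Dropping a generator
therefore always changes the lcm, so the Taylor complex, exact for any monomials by a cone homotopy
in each multidegree, is minimal. Its length is the number of generators, and a finite minimal free
resolution computes the projective dimension. Depth and projective dimension are obtained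
independently, without the Auslander–Buchsbaum formula. -/

/-! ### Regular sequences and associated primes -/

theorem exists_associatedPrime_between {R M : Type*} [CommRing R] [IsNoetherianRing R]
    [AddCommGroup M] [Module R M] [Module.Finite R M] (N : Submodule R M) (𝔪 : Ideal R)
    [𝔪.IsPrime] (h : Module.annihilator R N ≤ 𝔪) :
    ∃ Q ∈ associatedPrimes R M, Module.annihilator R N ≤ Q ∧ Q ≤ 𝔪 := by
  obtain ⟨Q, hQ, hQm⟩ := Ideal.exists_minimalPrimes_le h
  have := Module.associatedPrimes.minimalPrimes_annihilator_subset_associatedPrimes R N hQ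
  exact ⟨Q, associatedPrimes.subset_of_injective N.injective_subtype this, hQ.1.2, hQm⟩

-- The submodule `N` of elements killed by `P` has an image in `M / fM` that is killed by both `P`
-- and `f`, and `f ∉ P`, so an associated prime arising from this image is strictly larger than `P`.
-- The point is that the annihilator of the image stays inside `𝔪`; as `R` need not be local, a
-- determinant trick takes the place of Nakayama's lemma.
open Pointwise in
theorem exists_associatedPrime_quotSMulTop {R M : Type*} [CommRing R] [IsNoetherianRing R]
    [AddCommGroup M] [Module R M] [Module.Finite R M] {P 𝔪 : Ideal R} [𝔪.IsPrime]
    (hP : P ∈ associatedPrimes R M) (hPm : P ≤ 𝔪) {f : R} (hf : f ∈ 𝔪)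
    (hreg : IsSMulRegular M f) :
    ∃ Q ∈ associatedPrimes R (QuotSMulTop f M), P < Q ∧ Q ≤ 𝔪 := by
  obtain ⟨hPp, x, hx⟩ := Submodule.isAssociatedPrime_iff.1 hP
  have hxP : ∀ r, r ∈ P ↔ r • x = 0 := fun r => by
    rw [hx, Submodule.mem_colon_singleton, Submodule.mem_bot]
  have hx0 : x ≠ 0 := fun h => hPp.ne_top ((Ideal.eq_top_iff_one _).2 ((hxP 1).2 (by simp [h])))
  have hfP : f ∉ P := fun h => hx0 (hreg (by simpa using (hxP f).1 h))
  set N : Submodule R M := Submodule.torsionBySet R M P with hN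
  have hxN : x ∈ N := (Submodule.mem_torsionBySet_iff _ _).2 fun a => (hxP a).1 a.2
  set N' : Submodule R (QuotSMulTop f M) := N.map (Submodule.mkQ _) with hN'
  have hann : Module.annihilator R N' ≤ 𝔪 := by
    intro s hs
    -- If `s • y = f • z`, then `P` kills `f • z`, hence `z`, by regularity of `f`; so the quotient
    -- `z` is again in `N`.
    have key : ∀ y ∈ N, ∃ z ∈ N, s • y = f • z := by
      intro y hy
      have h1 := Submodule.mem_annihilator.1 hs _ (Submodule.mem_map_of_mem hy)
      rw [← map_smul, Submodule.mkQ_apply, Submodule.Quotient.mk_eq_zero,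
        Submodule.mem_smul_pointwise_iff_exists] at h1
      obtain ⟨z, -, hz⟩ := h1
      refine ⟨z, (Submodule.mem_torsionBySet_iff _ _).2 fun a => hreg ?_, hz.symm⟩
      have h2 := (Submodule.mem_torsionBySet_iff _ _).1 hy a
      show f • (a : R) • z = f • 0
      rw [smul_comm, hz, smul_comm, h2, smul_zero, smul_zero]
    -- Cayley–Hamilton for `s` acting on `N` with image in `fN`: evaluating at `x` puts `p(s)` in `P
    -- ≤ 𝔪`. All non-leading coefficients lie in `(f)`, so a power of `s` lies in `𝔪`.
    obtain ⟨p, hp, -, hpc, hpe⟩ :=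
      LinearMap.exists_monic_and_natDegree_eq_and_coeff_mem_pow_and_aeval_eq_zero
        R (algebraMap R (Module.End R N) s) (Ideal.span {f}) (by
        rintro _ ⟨y, rfl⟩
        obtain ⟨z, hz, h⟩ := key y y.2
        have : (algebraMap R (Module.End R N) s) y = f • ⟨z, hz⟩ := Subtype.ext h
        rw [this]
        exact Submodule.smul_mem_smul (Ideal.mem_span_singleton_self f) trivial)
    have hev : p.eval s ∈ 𝔪 := by
      refine hPm ((hxP _).2 ?_)
      rw [Polynomial.aeval_algebraMap_apply] at hpe
      have := congrArg (fun g : Module.End R N => ((g ⟨x, hxN⟩ : N) : M)) hpe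
      simpa using this
    rw [Polynomial.eval_eq_sum_range, Finset.sum_range_succ, hp.coeff_natDegree, one_mul] at hev
    refine Ideal.IsPrime.mem_of_pow_mem ‹_› p.natDegree ((Ideal.add_mem_iff_right _ ?_).1 hev)
    refine Ideal.sum_mem _ fun k hk => Ideal.mul_mem_right _ _ ?_
    have hk' : p.natDegree - k ≠ 0 := by have := Finset.mem_range.1 hk; omega
    exact (Ideal.span_singleton_le_iff_mem _).2 hf (Ideal.pow_le_self hk' (hpc k))
  obtain ⟨Q, hQ, hNQ, hQm⟩ := exists_associatedPrime_between N' 𝔪 hann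
  refine ⟨Q, hQ, lt_of_le_of_ne ?_ ?_, hQm⟩
  · refine le_trans (fun r hr => Submodule.mem_annihilator.2 ?_) hNQ
    rintro _ ⟨y, hy, rfl⟩
    rw [← map_smul, (Submodule.mem_torsionBySet_iff _ _).1 hy ⟨r, hr⟩, map_zero]
  · rintro rfl
    refine hfP (hNQ (Submodule.mem_annihilator.2 ?_))
    rintro _ ⟨y, hy, rfl⟩
    rw [← map_smul, Submodule.mkQ_apply, Submodule.Quotient.mk_eq_zero]
    exact Submodule.smul_mem_pointwise_smul _ _ _ trivial

/-- Each member of the sequence moves to a strictly larger associated prime inside `𝔪`, which lowers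
the dimension of the quotient by at least one. -/
theorem length_le_ringKrullDim_of_mem_associatedPrimes {R : Type*} [CommRing R]
    [IsNoetherianRing R] {𝔪 : Ideal R} [𝔪.IsPrime] (rs : List R) (hrs : ∀ r ∈ rs, r ∈ 𝔪)
    {M : Type*} [AddCommGroup M] [Module R M] [Module.Finite R M] {P : Ideal R}
    (hP : P ∈ associatedPrimes R M) (hPm : P ≤ 𝔪)
    (hreg : RingTheory.Sequence.IsWeaklyRegular M rs) :
    (rs.length : WithBot ℕ∞) ≤ ringKrullDim (R ⧸ P) := by
  induction rs generalizing M P with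
  | nil =>
    have := hP.1
    simpa using ringKrullDim_nonneg_of_nontrivial (R := R ⧸ P)
  | cons f rs ih =>
    rw [RingTheory.Sequence.isWeaklyRegular_cons_iff] at hreg
    obtain ⟨Q, hQ, hPQ, hQm⟩ := exists_associatedPrime_quotSMulTop hP hPm
      (hrs f (by simp)) hreg.1
    have h1 := ih (fun r hr => hrs r (by simp [hr])) hQ hQm hreg.2
    obtain ⟨hle, r, hrQ, hrP⟩ := SetLike.lt_iff_le_and_exists.1 hPQ
    have := hP.1
    have h2 := ringKrullDim_succ_le_of_surjective (Ideal.Quotient.factor hle)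
      (Ideal.Quotient.factor_surjective hle) (r := Ideal.Quotient.mk P r)
      (mem_nonZeroDivisors_of_ne_zero (by rwa [Ne, Ideal.Quotient.eq_zero_iff_mem]))
      (by rwa [Ideal.Quotient.factor_mk, Ideal.Quotient.eq_zero_iff_mem])
    rw [List.length_cons, Nat.cast_succ]
    exact le_trans (add_le_add_left h1 1) h2

theorem length_le_ringKrullDim_of_le_annihilator {R M : Type*} [CommRing R] [IsNoetherianRing R]
    [AddCommGroup M] [Module R M] [Module.Finite R M] {𝔪 J : Ideal R} [𝔪.IsPrime] (x : M)
    (hx : ∀ r : R, r • x = 0 → r ∈ 𝔪) (hJ : ∀ r ∈ J, r • x = 0) (rs : List R)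
    (hrs : ∀ r ∈ rs, r ∈ 𝔪) (hreg : RingTheory.Sequence.IsWeaklyRegular M rs) :
    (rs.length : WithBot ℕ∞) ≤ ringKrullDim (R ⧸ J) := by
  obtain ⟨P, hP, hJP, hPm⟩ := exists_associatedPrime_between (Submodule.span R {x}) 𝔪
    (fun r hr => hx r (Submodule.mem_annihilator.1 hr x (Submodule.mem_span_singleton_self x)))
  have hJP' : J ≤ P := le_trans (fun r hr => (Submodule.mem_annihilator_span_singleton x r).2
    (hJ r hr)) hJP
  exact (length_le_ringKrullDim_of_mem_associatedPrimes rs hrs hP hPm hreg).trans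
    (ringKrullDim_le_of_surjective _ (Ideal.Quotient.factor_surjective hJP'))

/-- Prime avoidance: if `𝔪` consisted of zero divisors, it would lie in a single associated prime
and so kill a nonzero element. -/
theorem exists_isSMulRegular_of_forall_eq_zero {R M : Type*} [CommRing R] [IsNoetherianRing R]
    [AddCommGroup M] [Module R M] [Module.Finite R M] (𝔪 : Ideal R)
    (h : ∀ x : M, (∀ r ∈ 𝔪, r • x = 0) → x = 0) : ∃ g ∈ 𝔪, IsSMulRegular M g := by
  by_contra! hcon
  have h1 : (𝔪 : Set R) ⊆ ⋃ p ∈ associatedPrimes R M, p := by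
    rw [biUnion_associatedPrimes_eq_compl_regular]
    exact fun g hg => hcon g hg
  have hfin := associatedPrimes.finite R M
  obtain ⟨p, hp, hle⟩ := (Ideal.subset_union_prime_finite hfin 0 0
    (fun p hp _ _ => IsAssociatedPrime.isPrime hp)).1 h1
  obtain ⟨hpp, x, hx⟩ := Submodule.isAssociatedPrime_iff.1 hp
  have hx0 := h x fun r hr => by
    have := hle hr
    rwa [hx, Submodule.mem_colon_singleton, Submodule.mem_bot] at this
  refine hpp.ne_top ((Ideal.eq_top_iff_one _).2 ?_)
  rw [hx, Submodule.mem_colon_singleton, hx0, smul_zero]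
  exact zero_mem _

/-! ### Projective dimension from a minimal resolution -/

section Resolution

open CategoryTheory

universe u

variable {S : Type u} [CommRing S] {M : Type u} [AddCommGroup M] [Module S M]

theorem hasProjectiveDimensionLT_of_resolution (r : ℕ)
    (F : ℕ → Type u) [∀ p, AddCommGroup (F p)] [∀ p, Module S (F p)]
    (d : ∀ p, F (p + 1) →ₗ[S] F p) (ε : F 0 →ₗ[S] M) (hF : ∀ p, Module.Projective S (F p))
    (hε : Function.Surjective ε) (h0 : Function.Exact (d 0) ε)
    (hd : ∀ p, Function.Exact (d (p + 1)) (d p)) (hr : Subsingleton (F r)) :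
    HasProjectiveDimensionLT (ModuleCat.of S M) r := by
  induction r generalizing M F with
  | zero =>
    have : Subsingleton M := hε.subsingleton
    exact (hasProjectiveDimensionLT_zero_iff_isZero _).2 (ModuleCat.isZero_of_subsingleton _)
  | succ r ih =>
    have := ih (M := LinearMap.ker ε) (fun p => F (p + 1)) (fun p => d (p + 1))
      ((d 0).codRestrict _ fun x => (h0 (d 0 x)).2 ⟨x, rfl⟩)
      (fun p => hF _) (fun ⟨y, hy⟩ => by
        obtain ⟨x, hx⟩ := (h0 y).1 hy
        exact ⟨x, Subtype.ext hx⟩) (fun x => by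
        rw [← hd 0 x]
        exact ⟨fun h => congrArg Subtype.val h, fun h => Subtype.ext h⟩)
      (fun p => hd _) hr
    have hP : Projective (ModuleCat.of S (F 0)) := inferInstance
    exact (LinearMap.shortExact_shortComplexKer hε).hasProjectiveDimensionLT_X₃ r this
      (hasProjectiveDimensionLT_of_ge (ModuleCat.of S (F 0)) 1 (r + 1) (by omega))

/-- Passing to the first syzygy shifts the dimension, so only `r = 0` and `r = 1` carry content.
There minimality would force `𝔪 F_r = F_r`. -/
theorem not_hasProjectiveDimensionLT_of_minimal_resolution (𝔪 : Ideal S) (r : ℕ)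
    (F : ℕ → Type u) [∀ p, AddCommGroup (F p)] [∀ p, Module S (F p)]
    (d : ∀ p, F (p + 1) →ₗ[S] F p) (ε : F 0 →ₗ[S] M) (hF : ∀ p, Module.Projective S (F p))
    (hε : Function.Surjective ε) (h0 : Function.Exact (d 0) ε)
    (hd : ∀ p, Function.Exact (d (p + 1)) (d p))
    (hmin : ∀ p, LinearMap.range (d p) ≤ 𝔪 • (⊤ : Submodule S (F p)))
    (hr : 𝔪 • (⊤ : Submodule S (F r)) ≠ ⊤) :
    ¬ HasProjectiveDimensionLT (ModuleCat.of S M) r := by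
  intro hM
  induction r generalizing M F with
  | zero =>
    have : Subsingleton M :=
      ModuleCat.isZero_iff_subsingleton.1 ((hasProjectiveDimensionLT_zero_iff_isZero _).1 hM)
    refine hr (top_le_iff.1 (le_trans (fun x _ => ?_) (hmin 0)))
    exact (h0 x).1 (Subsingleton.elim _ _)
  | succ r ih =>
    let ε' : F 1 →ₗ[S] LinearMap.ker ε :=
      (d 0).codRestrict _ fun x => (h0 (d 0 x)).2 ⟨x, rfl⟩
    have hε' : Function.Surjective ε' := fun ⟨y, hy⟩ => by
      obtain ⟨x, hx⟩ := (h0 y).1 hy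
      exact ⟨x, Subtype.ext hx⟩
    have h0' : Function.Exact (d 1) ε' := fun x => by
      rw [← hd 0 x]
      exact ⟨fun h => congrArg Subtype.val h, fun h => Subtype.ext h⟩
    have hP : Projective (ModuleCat.of S (F 0)) := inferInstance
    rcases r with _ | r
    -- If `M` is projective, `ker ε` is a direct summand of `F 0` with projection `ρ`, so an element
    -- of `ker ε` in `𝔪 F 0` already lies in `𝔪 ker ε`. Lifting through `ε'` and using minimality of
    -- `d 1` gives `F 1 = 𝔪 F 1`.
    · have hproj : Projective (ModuleCat.of S M) := projective_iff_hasProjectiveDimensionLT_one.2 hM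
      have hproj' : Module.Projective S M := (IsProjective.iff_projective M).2 hproj
      obtain ⟨s, hs⟩ := Module.projective_lifting_property ε LinearMap.id hε
      let ρ : F 0 →ₗ[S] LinearMap.ker ε :=
        (LinearMap.id - s ∘ₗ ε).codRestrict _ fun x => by
          have := LinearMap.congr_fun hs (ε x)
          simpa [sub_eq_zero] using this.symm
      have hρ : ∀ y : LinearMap.ker ε, ρ y = y := fun y => Subtype.ext (by
        have : ε y = 0 := y.2
        simp [ρ, this])
      refine hr (top_le_iff.1 fun z _ => ?_)
      have h1 : ε' z ∈ 𝔪 • (⊤ : Submodule S (LinearMap.ker ε)) := by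
        have h2 : (ε' z : F 0) ∈ 𝔪 • (⊤ : Submodule S (F 0)) := hmin 0 ⟨z, rfl⟩
        have h3 := Submodule.mem_map_of_mem (f := ρ) h2
        rw [Submodule.map_smul'', hρ] at h3
        exact Submodule.smul_mono le_rfl le_top h3
      have h4 : ε' z ∈ (𝔪 • (⊤ : Submodule S (F 1))).map ε' := by
        rwa [Submodule.map_smul'', Submodule.map_top, LinearMap.range_eq_top.2 hε']
      obtain ⟨w, hw, hwz⟩ := h4
      have h5 : z - w ∈ 𝔪 • (⊤ : Submodule S (F 1)) :=
        hmin 1 ((h0' (z - w)).1 (by rw [map_sub, hwz, sub_self]))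
      simpa using Submodule.add_mem _ h5 hw
    · exact ih (M := LinearMap.ker ε) (fun p => F (p + 1)) (fun p => d (p + 1)) ε'
        (fun p => hF _) hε' h0' (fun p => hd _) (fun p => hmin _) hr
        ((LinearMap.shortExact_shortComplexKer hε).hasProjectiveDimensionLT_X₃_iff r hP |>.1 hM)

theorem IsMinimalFreeResolution.projectiveDimension_eq {𝔪 : Ideal S} (h𝔪 : 𝔪 ≠ ⊤)
    {F : ℕ → Type u} [∀ p, AddCommGroup (F p)] [∀ p, Module S (F p)]
    {d : ∀ p, F (p + 1) →ₗ[S] F p} {ε : F 0 →ₗ[S] M} (h : IsMinimalFreeResolution 𝔪 F d ε)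
    (r : ℕ) (hr : Nontrivial (F r)) (hr' : Subsingleton (F (r + 1))) :
    projectiveDimension (ModuleCat.of S M) = r := by
  have hF : ∀ p, Module.Projective S (F p) := fun p => have := h.free p; inferInstance
  refine le_antisymm ?_ ?_
  · rw [projectiveDimension_le_iff]
    exact hasProjectiveDimensionLT_of_resolution (r + 1) F d ε hF h.surjective h.exact_zero
      h.exact_succ hr'
  · rw [projectiveDimension_ge_iff]
    refine not_hasProjectiveDimensionLT_of_minimal_resolution 𝔪 r F d ε hF h.surjective
      h.exact_zero h.exact_succ h.minimal fun htop => ?_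
    have := h.free r
    let b := Module.Free.chooseBasis S (F r)
    obtain ⟨i⟩ : Nonempty (Module.Free.ChooseBasisIndex S (F r)) := b.index_nonempty
    have h1 : b i ∈ 𝔪 • (⊤ : Submodule S (F r)) :=
      htop.ge Submodule.mem_top
    have h2 := Submodule.mem_map_of_mem (f := b.coord i) h1
    rw [Submodule.map_smul'', Module.Basis.coord_apply, Module.Basis.repr_self,
      Finsupp.single_eq_same] at h2
    exact h𝔪 ((Ideal.eq_top_iff_one _).2 
      ((Submodule.smul_le (P := 𝔪)).2 (fun a ha x _ => 𝔪.mul_mem_right x ha) h2))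

end Resolution

/-! ### Stanley–Reisner ideals and regular elements -/

section StanleyReisner

variable {K : Type*} [Field K] {n : ℕ}

/-- `I` is the Stanley–Reisner ideal of the simplicial complex `Δ` on the variables: it consists
of the polynomials none of whose monomials is supported on a face of `Δ`. -/
def IsFaceIdeal (Δ : Set (Finset (Fin n))) (I : Ideal (MvPolynomial (Fin n) K)) : Prop :=
  ∀ p, p ∈ I ↔ ∀ u : Fin n →₀ ℕ, u.support ∈ Δ → coeff u p = 0

theorem mem_idealOfVars_iff_coeff_zero (p : MvPolynomial (Fin n) K) :
    p ∈ idealOfVars (Fin n) K ↔ coeff 0 p = 0 := by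
  have := mem_pow_idealOfVars_iff' 1 p
  rw [pow_one] at this
  rw [this]
  exact ⟨fun h => h 0 (by simp), fun h x hx => by
    rw [Nat.lt_one_iff, Finsupp.degree_eq_zero_iff] at hx
    rwa [hx]⟩

instance idealOfVars_isPrime : (idealOfVars (Fin n) K).IsPrime := by
  have : idealOfVars (Fin n) K = RingHom.ker (constantCoeff (R := K) (σ := Fin n)) := by
    ext p
    rw [mem_idealOfVars_iff_coeff_zero, RingHom.mem_ker, constantCoeff_eq]
  rw [this]
  exact RingHom.ker_isPrime _

namespace IsFaceIdeal

variable {Δ : Set (Finset (Fin n))} {I : Ideal (MvPolynomial (Fin n) K)}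

theorem le_idealOfVars (hI : IsFaceIdeal Δ I) (h0 : ∅ ∈ Δ) : I ≤ idealOfVars (Fin n) K :=
  fun p hp => (mem_idealOfVars_iff_coeff_zero p).2 ((hI p).1 hp 0 (by simpa using h0))

theorem isRegular_of_isWeaklyRegular (hI : I ≤ idealOfVars (Fin n) K)
    {rs : List (MvPolynomial (Fin n) K)} (hrs : ∀ f ∈ rs, f ∈ idealOfVars (Fin n) K)
    (h : RingTheory.Sequence.IsWeaklyRegular (MvPolynomial (Fin n) K ⧸ I) rs) :
    RingTheory.Sequence.IsRegular (MvPolynomial (Fin n) K ⧸ I) rs := by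
  refine ⟨h, fun htop => ?_⟩
  have h1 : Submodule.mkQ I 1 ∈ Ideal.ofList rs • (⊤ : Submodule _ (_ ⧸ I)) :=
    htop ▸ Submodule.mem_top
  have h2 : Ideal.ofList rs ≤ idealOfVars (Fin n) K := Ideal.span_le.2 hrs
  have h3 := Submodule.mem_map_of_mem (f := Submodule.factor hI) (Submodule.smul_mono_left h2 h1)
  rw [Submodule.map_smul''] at h3
  have h4 : idealOfVars (Fin n) K • (Submodule.map (Submodule.factor hI) ⊤) ≤ ⊥ := by
    refine Submodule.smul_le.2 fun r hr x _ => ?_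
    obtain ⟨y, rfl⟩ := Submodule.mkQ_surjective _ x
    rw [← map_smul, Submodule.mem_bot, Submodule.mkQ_apply, Submodule.Quotient.mk_eq_zero]
    exact Ideal.mul_mem_right _ _ hr
  have h5 := h4 h3
  rw [Submodule.mem_bot] at h5
  have h6 : (Submodule.mkQ (idealOfVars (Fin n) K)) 1 = 0 := h5
  rw [Submodule.mkQ_apply, Submodule.Quotient.mk_eq_zero] at h6
  exact (idealOfVars_isPrime (K := K) (n := n)).ne_top ((Ideal.eq_top_iff_one _).2 h6)

theorem isSMulRegular_iff (f : MvPolynomial (Fin n) K) :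
    IsSMulRegular (MvPolynomial (Fin n) K ⧸ I) f ↔ ∀ p, f * p ∈ I → p ∈ I :=
  isSMulRegular_quotient_iff_mem_of_smul_mem I f

theorem coeff_X_mul_add_single (c : Fin n) (u : Fin n →₀ ℕ) (p : MvPolynomial (Fin n) K) :
    coeff (u + Finsupp.single c 1) (X c * p) = coeff u p := by
  rw [add_comm, coeff_X_mul]

theorem support_add_single (u : Fin n →₀ ℕ) (c : Fin n) :
    (u + Finsupp.single c 1).support = insert c u.support := by
  ext a
  simp only [Finsupp.mem_support_iff, Finsupp.add_apply, Finsupp.single_apply, Finset.mem_insert]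
  by_cases h : c = a
  · simp [h]
  · simp [h, Ne.symm h]

/-- The variable of a cone point is regular. -/
theorem isSMulRegular_X (hI : IsFaceIdeal Δ I) (c : Fin n) (hc : ∀ s ∈ Δ, insert c s ∈ Δ) :
    IsSMulRegular (MvPolynomial (Fin n) K ⧸ I) (X c : MvPolynomial (Fin n) K) := by
  rw [isSMulRegular_iff]
  intro p hp
  refine (hI p).2 fun u hu => ?_
  rw [← coeff_X_mul_add_single c]
  exact (hI _).1 hp _ (by rw [support_add_single]; exact hc _ hu)

/-- Killing a variable deletes its vertex; this keeps the induction over cone points within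
Stanley–Reisner ideals. -/
theorem sup_span_X (hI : IsFaceIdeal Δ I) (c : Fin n) :
    IsFaceIdeal {s ∈ Δ | c ∉ s} (I ⊔ Ideal.span {X c}) := by
  intro p
  constructor
  · intro hp u hu
    obtain ⟨a, ha, b, hb, rfl⟩ := Submodule.mem_sup.1 hp
    obtain ⟨q, rfl⟩ := Ideal.mem_span_singleton'.1 hb
    rw [coeff_add, (hI a).1 ha u hu.1, zero_add, mul_comm, coeff_X_mul', if_neg hu.2]
  · intro hp
    rw [p.as_sum]
    refine Ideal.sum_mem _ fun u hu => ?_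
    by_cases hc : c ∈ u.support
    · refine Ideal.mem_sup_right (Ideal.mem_span_singleton.2 ?_)
      rw [X, monomial_dvd_monomial]
      refine ⟨Or.inr ?_, one_dvd _⟩
      rw [Finsupp.single_le_iff]
      exact Nat.one_le_iff_ne_zero.2 (Finsupp.mem_support_iff.1 hc)
    · refine Ideal.mem_sup_left ((hI _).2 fun v hv => ?_)
      rw [coeff_monomial]
      split_ifs with h
      · subst h
        exact hp u ⟨hv, hc⟩
      · rfl

theorem lt_add_single_sub_single (u : Fin n →₀ ℕ) (c : Fin n) (hc : ∀ l ∈ u.support, c ≤ l)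
    (l : Fin n) (hl : l ∈ (u + Finsupp.single c 1).support) (hlc : l ≠ c) :
    toLex u < toLex (u + Finsupp.single c 1 - Finsupp.single l 1) := by
  have hlu : l ∈ u.support := by
    rw [support_add_single] at hl
    exact (Finset.mem_insert.1 hl).resolve_left hlc
  have hcl : c < l := lt_of_le_of_ne (hc l hlu) hlc.symm
  refine Finsupp.Lex.lt_iff.2 ⟨c, fun j hj => ?_, ?_⟩
  · change u j = u j + Finsupp.single c 1 j - Finsupp.single l 1 j
    rw [Finsupp.single_eq_of_ne hj.ne, Finsupp.single_eq_of_ne (hj.trans hcl).ne, add_zero,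
      tsub_zero]
  · change u c < u c + Finsupp.single c 1 c - Finsupp.single l 1 c
    rw [Finsupp.single_eq_same, Finsupp.single_eq_of_ne hlc.symm]
    omega

/-- The sum of the variables is regular modulo a Stanley–Reisner ideal with at least one vertex. -/
theorem isSMulRegular_sum_X (hI : IsFaceIdeal Δ I) (hΔ : IsLowerSet Δ) {c₀ : Fin n}
    (hc₀ : {c₀} ∈ Δ) :
    IsSMulRegular (MvPolynomial (Fin n) K ⧸ I) (∑ c, X c : MvPolynomial (Fin n) K) := by
  classical
  rw [isSMulRegular_iff]
  intro p hp
  by_contra hpI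
  let F : Finset (Lex (Fin n →₀ ℕ)) :=
    (p.support.filter fun u => u.support ∈ Δ).map toLex.toEmbedding
  have hFm : ∀ u : Fin n →₀ ℕ, toLex u ∈ F ↔ coeff u p ≠ 0 ∧ u.support ∈ Δ := fun u => by
    simp [F]
  have hF : F.Nonempty := by
    rw [hI] at hpI
    push Not at hpI
    obtain ⟨u, hu, hu'⟩ := hpI
    exact ⟨toLex u, (hFm u).2 ⟨hu', hu⟩⟩
  -- Take the lex-largest monomial `u` of `p` supported on a face, and let `c` be its first variable
  -- (`c₀` if `u = 1`). In `(∑ x_l) p` the monomial `u x_c` can otherwise come only from some `u x_c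
  -- / x_l` with `l > c`, which is lex-larger than `u` and still supported on a face, so its
  -- coefficient vanishes.
  obtain ⟨u, hu⟩ : ∃ u : Fin n →₀ ℕ, toLex u = F.max' hF := ⟨ofLex (F.max' hF), rfl⟩
  have hmax : ∀ v : Fin n →₀ ℕ, v.support ∈ Δ → toLex u < toLex v → coeff v p = 0 := by
    intro v hv huv
    by_contra hcv
    exact absurd (F.le_max' _ ((hFm v).2 ⟨hcv, hv⟩)) (not_le.2 (hu ▸ huv))
  obtain ⟨hu0, huΔ⟩ := (hFm u).1 (hu ▸ F.max'_mem hF)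
  obtain ⟨c, hc, hcΔ⟩ : ∃ c, (∀ l ∈ u.support, c ≤ l) ∧ insert c u.support ∈ Δ := by
    by_cases h : u.support.Nonempty
    · exact ⟨u.support.min' h, fun l hl => Finset.min'_le _ _ hl, by
        rwa [Finset.insert_eq_of_mem (Finset.min'_mem _ _)]⟩
    · rw [Finset.not_nonempty_iff_eq_empty] at h
      exact ⟨c₀, by simp [h], by simpa [h] using hc₀⟩
  have h1 := (hI _).1 hp (u + Finsupp.single c 1) (by rwa [support_add_single])
  rw [Finset.sum_mul, coeff_sum, Finset.sum_eq_single c] at h1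
  · exact hu0 (by rwa [coeff_X_mul_add_single] at h1)
  · intro l _ hlc
    rw [coeff_X_mul']
    split_ifs with hl
    · refine hmax _ (hΔ ?_ hcΔ) (lt_add_single_sub_single u c hc l hl hlc)
      rw [← support_add_single]
      exact Finsupp.support_tsub
    · rfl
  · simp

/-- The vanishing of the first Koszul cohomology of the Stanley–Reisner ring of a connected
complex with at least two vertices. -/
theorem exists_forall_sub_X_mul_mem (hI : IsFaceIdeal Δ I)
    (hne : ∀ l, ∃ m ≠ l, {m} ∈ Δ)
    (hconn : ∀ f : Fin n → K, (∀ l m, l ≠ m → {l, m} ∈ Δ → f l = f m) →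
      ∀ l m, {l} ∈ Δ → {m} ∈ Δ → f l = f m)
    (q : Fin n → MvPolynomial (Fin n) K) (hq : ∀ l m, X m * q l - X l * q m ∈ I) :
    ∃ g, ∀ l, q l - X l * g ∈ I := by
  classical
  have hcoeff : ∀ l m (v : Fin n →₀ ℕ), v.support ∈ Δ →
      coeff v (X m * q l) = coeff v (X l * q m) := fun l m v hv => by
    rw [← sub_eq_zero, ← coeff_sub]
    exact (hI _).1 (hq l m) v hv
  have hsupp : ∀ w l, (w + Finsupp.single l 1).support ∈ Δ → insert l w.support ∈ Δ :=
    fun w l h => by rwa [support_add_single] at h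
  -- The coefficient of `w` in `g` has to be that of `w x_l` in `q l`, whatever `l` is. For `w ≠ 0`
  -- all choices are compared with a variable already in `w`; for `w = 0` independence of `l` is
  -- exactly connectedness.
  have hex : ∀ w : Fin n →₀ ℕ, ∃ a : K, ∀ l, (w + Finsupp.single l 1).support ∈ Δ →
      coeff (w + Finsupp.single l 1) (q l) = a := by
    have hstep : ∀ (w : Fin n →₀ ℕ) (l m : Fin n),
        (w + Finsupp.single l 1 + Finsupp.single m 1).support ∈ Δ →
        coeff (w + Finsupp.single l 1) (q l) = coeff (w + Finsupp.single m 1) (q m) := by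
      intro w l m h
      have := hcoeff l m _ h
      rwa [coeff_X_mul_add_single, add_right_comm, coeff_X_mul_add_single] at this
    intro w
    by_cases hw : w = 0
    · subst hw
      let f : Fin n → K := fun l => coeff (Finsupp.single l 1) (q l)
      have hf := hconn f fun l m _ hlm => by
        have := hstep 0 l m (by
          rw [support_add_single, support_add_single]
          simpa [Finset.pair_comm] using hlm)
        simpa [f] using this
      by_cases hv : ∃ c, {c} ∈ Δ
      · obtain ⟨c, hc⟩ := hv
        refine ⟨f c, fun l hl => ?_⟩
        have := hf l c (by simpa using hsupp 0 l hl) hc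
        simpa [f] using this
      · exact ⟨0, fun l hl => absurd ⟨l, by simpa using hsupp 0 l hl⟩ hv⟩
    · obtain ⟨c, hc⟩ := Finsupp.support_nonempty_iff.2 hw
      refine ⟨coeff (w + Finsupp.single c 1) (q c), fun l hl => hstep w l c ?_⟩
      rw [support_add_single, Finset.insert_eq_of_mem]
      · exact hl
      · rw [support_add_single]
        exact Finset.mem_insert_of_mem hc
  choose a ha using hex
  -- Only these finitely many `w` can carry a nonzero prescribed coefficient, so `g` is a
  -- polynomial.
  let F : Finset (Fin n →₀ ℕ) :=
    Finset.univ.biUnion fun l => (q l).support.image fun u => u - Finsupp.single l 1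
  have hg : ∀ w l, (w + Finsupp.single l 1).support ∈ Δ →
      coeff w (∑ w ∈ F, monomial w (a w)) = coeff (w + Finsupp.single l 1) (q l) := by
    intro w l hwl
    rw [coeff_sum]
    simp only [coeff_monomial, Finset.sum_ite_eq']
    split_ifs with hwF
    · exact (ha w l hwl).symm
    · by_contra hcon
      refine hwF (Finset.mem_biUnion.2 ⟨l, Finset.mem_univ _, Finset.mem_image.2
        ⟨w + Finsupp.single l 1, mem_support_iff.2 (Ne.symm hcon), ?_⟩⟩)
      rw [add_tsub_cancel_right]
  refine ⟨∑ w ∈ F, monomial w (a w), fun l => (hI _).2 fun u hu => ?_⟩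
  rw [coeff_sub, sub_eq_zero, coeff_X_mul']
  split_ifs with hl
  · have hle : Finsupp.single l 1 ≤ u :=
      Finsupp.single_le_iff.2 (Nat.one_le_iff_ne_zero.2 (Finsupp.mem_support_iff.1 hl))
    rw [hg (u - Finsupp.single l 1) l (by rwa [tsub_add_cancel_of_le hle]),
      tsub_add_cancel_of_le hle]
  -- When `x_l` does not divide `u`, the coefficient of `u` in `q l` must vanish: compare
  -- coefficients of `u x_m` in `x_m q_l` and `x_l q_m`, the latter being zero. A second vertex is
  -- needed when `u = 1`.
  · obtain ⟨m, hml, hm⟩ : ∃ m ≠ l, insert m u.support ∈ Δ := by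
      by_cases h0 : u = 0
      · obtain ⟨m, hml, hm⟩ := hne l
        exact ⟨m, hml, by simpa [h0] using hm⟩
      · obtain ⟨m, hm⟩ := Finsupp.support_nonempty_iff.2 h0
        exact ⟨m, fun h => hl (h ▸ hm), by rwa [Finset.insert_eq_of_mem hm]⟩
    have := hcoeff l m (u + Finsupp.single m 1) (by rwa [support_add_single])
    rw [coeff_X_mul_add_single, coeff_X_mul', if_neg] at this
    · exact this
    · rw [support_add_single, Finset.mem_insert, not_or]
      exact ⟨hml.symm, hl⟩

-- The first element is the sum `θ` of the variables. If every variable kills the class of `h`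
-- modulo `I + (θ)`, write `x_c h ≡ θ q_c`; cancelling `θ` gives `x_m q_l ≡ x_l q_m`, hence `q_c ≡
-- x_c r` for a common `r`. Summing over `c` yields `θ h ≡ θ² r`, and so `h ≡ θ r`. Thus the
-- quotient has no socle, and prime avoidance supplies the second element.
open Pointwise in
theorem exists_isWeaklyRegular_pair (hI : IsFaceIdeal Δ I) (hΔ : IsLowerSet Δ)
    {c₀ : Fin n} (hc₀ : {c₀} ∈ Δ) (hne : ∀ l, ∃ m ≠ l, {m} ∈ Δ)
    (hconn : ∀ f : Fin n → K, (∀ l m, l ≠ m → {l, m} ∈ Δ → f l = f m) →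
      ∀ l m, {l} ∈ Δ → {m} ∈ Δ → f l = f m) :
    ∃ f ∈ idealOfVars (Fin n) K, ∃ g ∈ idealOfVars (Fin n) K,
      RingTheory.Sequence.IsWeaklyRegular (MvPolynomial (Fin n) K ⧸ I) [f, g] := by
  have hθ := hI.isSMulRegular_sum_X hΔ hc₀
  have hθ' := (isSMulRegular_iff _).1 hθ
  have hX : ∀ c : Fin n, (X c : MvPolynomial (Fin n) K) ∈ idealOfVars (Fin n) K :=
    fun c => Ideal.subset_span ⟨c, rfl⟩
  obtain ⟨g, hg, hreg⟩ := exists_isSMulRegular_of_forall_eq_zero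
    (M := QuotSMulTop (∑ c, X c : MvPolynomial (Fin n) K) (MvPolynomial (Fin n) K ⧸ I))
    (idealOfVars (Fin n) K) (by
    intro x hx
    obtain ⟨x, rfl⟩ := Submodule.mkQ_surjective _ x
    obtain ⟨h, rfl⟩ := Submodule.mkQ_surjective _ x
    have hmem : ∀ p : MvPolynomial (Fin n) K, Submodule.mkQ I p ∈
        (∑ c, X c : MvPolynomial (Fin n) K) •
          (⊤ : Submodule (MvPolynomial (Fin n) K) (MvPolynomial (Fin n) K ⧸ I)) ↔
        ∃ q, p - (∑ c, X c) * q ∈ I := by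
      intro p
      rw [Submodule.mem_smul_pointwise_iff_exists]
      constructor
      · rintro ⟨y, -, hy⟩
        obtain ⟨q, rfl⟩ := Submodule.mkQ_surjective _ y
        refine ⟨q, ?_⟩
        rw [← Submodule.Quotient.mk_eq_zero, ← Submodule.mkQ_apply, map_sub, ← hy,
          ← smul_eq_mul, map_smul, sub_self]
      · rintro ⟨q, hq⟩
        refine ⟨Submodule.mkQ I q, trivial, ?_⟩
        rw [← map_smul, eq_comm, ← sub_eq_zero, ← map_sub, Submodule.mkQ_apply,
          Submodule.Quotient.mk_eq_zero]
        exact hq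
    have h1 : ∀ c, ∃ q, X c * h - (∑ c, X c) * q ∈ I := fun c => by
      have := hx _ (hX c)
      rw [← map_smul, ← map_smul, Submodule.mkQ_apply, Submodule.Quotient.mk_eq_zero, hmem] at this
      exact this
    choose q hq using h1
    obtain ⟨r, hr⟩ := hI.exists_forall_sub_X_mul_mem hne hconn q fun l m => hθ' _ (by
      have := I.sub_mem (I.mul_mem_left (X l) (hq m)) (I.mul_mem_left (X m) (hq l))
      convert this using 1
      ring)
    rw [Submodule.mkQ_apply, Submodule.Quotient.mk_eq_zero, hmem]
    refine ⟨r, hθ' _ ?_⟩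
    rw [Finset.sum_mul]
    refine Ideal.sum_mem _ fun c _ => ?_
    have := I.add_mem (hq c) (I.mul_mem_left (∑ c, X c) (hr c))
    convert this using 1
    ring)
  refine ⟨∑ c, X c, Ideal.sum_mem _ fun c _ => hX c, g, hg, ?_⟩
  rw [RingTheory.Sequence.isWeaklyRegular_cons_iff,
    RingTheory.Sequence.isWeaklyRegular_singleton_iff]
  exact ⟨hθ, hreg⟩

end IsFaceIdeal

end StanleyReisner

/-! ### Iterated cones, facets and depth -/

section StanleyReisner

variable {K : Type*} [Field K] {n : ℕ}

namespace IsFaceIdeal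

open Pointwise in
theorem exists_isWeaklyRegular_of_cone (V : Finset (Fin n)) {Δ : Set (Finset (Fin n))}
    {I : Ideal (MvPolynomial (Fin n) K)} (hI : IsFaceIdeal Δ I)
    (hV : ∀ c ∈ V, ∀ s ∈ Δ, insert c s ∈ Δ)
    (h : ∀ J : Ideal (MvPolynomial (Fin n) K), IsFaceIdeal {s ∈ Δ | Disjoint V s} J →
      ∃ f ∈ idealOfVars (Fin n) K, ∃ g ∈ idealOfVars (Fin n) K,
        RingTheory.Sequence.IsWeaklyRegular (MvPolynomial (Fin n) K ⧸ J) [f, g]) :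
    ∃ rs : List (MvPolynomial (Fin n) K), rs.length = V.card + 2 ∧
      (∀ f ∈ rs, f ∈ idealOfVars (Fin n) K) ∧
      RingTheory.Sequence.IsWeaklyRegular (MvPolynomial (Fin n) K ⧸ I) rs := by
  induction V using Finset.induction_on generalizing Δ I with
  | empty =>
    obtain ⟨f, hf, g, hg, hfg⟩ := h I (by simpa using hI)
    exact ⟨[f, g], rfl, by simp [hf, hg], hfg⟩
  | insert c V hcV ih =>
    have hI' := hI.sup_span_X c
    obtain ⟨rs, hlen, hrs, hreg⟩ := ih hI' (fun d hd s hs =>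
      ⟨hV d (Finset.mem_insert_of_mem hd) s hs.1, fun hc =>
        (Finset.mem_insert.1 hc).elim (fun h => hcV (h ▸ hd)) hs.2⟩) (fun J hJ => by
      refine h J ?_
      convert hJ using 1
      ext s
      simp only [Set.mem_ofPred_eq, Finset.disjoint_insert_left, and_assoc])
    refine ⟨X c :: rs, by rw [List.length_cons, hlen, Finset.card_insert_of_notMem hcV,
      add_right_comm], ?_, ?_⟩
    · intro f hf
      rcases List.mem_cons.1 hf with rfl | hf
      · exact Ideal.subset_span ⟨c, rfl⟩
      · exact hrs f hf
    · rw [RingTheory.Sequence.isWeaklyRegular_cons_iff]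
      refine ⟨hI.isSMulRegular_X c (hV c (Finset.mem_insert_self c V)), ?_⟩
      have hmap : Submodule.map (Submodule.mkQ I) (I ⊔ Ideal.span {X c}) =
          (X c : MvPolynomial (Fin n) K) • (⊤ : Submodule _ (MvPolynomial (Fin n) K ⧸ I)) := by
        rw [Submodule.map_sup, LinearMap.le_ker_iff_map.1 (Submodule.ker_mkQ I).ge, bot_sup_eq,
          ← Submodule.ideal_span_singleton_smul]
        conv_lhs => rw [← mul_one (Ideal.span {X c}), Ideal.one_eq_top, ← smul_eq_mul]
        rw [Submodule.map_smul'', Submodule.map_top, Submodule.range_mkQ]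
      let e := (Submodule.quotEquivOfEq _ _ hmap.symm).trans
        (Submodule.quotientQuotientEquivQuotient I (I ⊔ Ideal.span {X c}) le_sup_left)
      exact (e.isWeaklyRegular_congr rs).2 hreg

/-- The product of the variables of a facet is nonzero modulo `I` and is killed by every variable
outside the facet, so the length is at most the dimension of the polynomial ring on `F`. -/
theorem length_le_card_facet {Δ : Set (Finset (Fin n))}
    {I : Ideal (MvPolynomial (Fin n) K)} (hI : IsFaceIdeal Δ I) (F : Finset (Fin n))
    (hF : F ∈ Δ) (hmax : ∀ c ∉ F, insert c F ∉ Δ) (hΔ : IsLowerSet Δ)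
    (rs : List (MvPolynomial (Fin n) K)) (hrs : ∀ f ∈ rs, f ∈ idealOfVars (Fin n) K)
    (hreg : RingTheory.Sequence.IsWeaklyRegular (MvPolynomial (Fin n) K ⧸ I) rs) :
    rs.length ≤ F.card := by
  let u : Fin n →₀ ℕ := Finsupp.equivFunOnFinite.symm fun c => if c ∈ F then 1 else 0
  have hu : u.support = F := by
    ext c
    simp [u]
  let J : Ideal (MvPolynomial (Fin n) K) := Ideal.span (X '' {c : Fin n | c ∉ F})
  have hdim := length_le_ringKrullDim_of_le_annihilator (𝔪 := idealOfVars (Fin n) K)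
    (J := J) (Submodule.mkQ I (monomial u (1 : K)))
    (fun r hr => by
      rw [← map_smul, Submodule.mkQ_apply, Submodule.Quotient.mk_eq_zero, smul_eq_mul] at hr
      have := (hI _).1 hr u (by rwa [hu])
      rw [coeff_mul_monomial', if_pos le_rfl, tsub_self, mul_one] at this
      rwa [mem_idealOfVars_iff_coeff_zero])
    (fun r hr => by
      rw [← map_smul, Submodule.mkQ_apply, Submodule.Quotient.mk_eq_zero, smul_eq_mul]
      refine (hI _).2 fun v hv => ?_
      rw [coeff_mul_monomial', mul_one]
      split_ifs with huv
      · by_contra hcon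
        obtain ⟨c, hcF, hc⟩ := mem_ideal_span_X_image.1 hr _ (mem_support_iff.2 hcon)
        have hvc : c ∈ v.support := Finsupp.support_tsub (Finsupp.mem_support_iff.2 hc)
        refine hmax c hcF (hΔ (Finset.insert_subset hvc ?_) hv)
        rw [← hu]
        exact Finsupp.support_mono huv
      · rfl) rs hrs hreg
  let φ : MvPolynomial F K →+* MvPolynomial (Fin n) K ⧸ J :=
    (Ideal.Quotient.mk J).comp (rename (Subtype.val : F → Fin n)).toRingHom
  have hφ : Function.Surjective φ := by
    intro y
    obtain ⟨p, rfl⟩ := Ideal.Quotient.mk_surjective y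
    induction p using MvPolynomial.induction_on with
    | C a => exact ⟨C a, by simp [φ]⟩
    | add p q hp hq =>
      obtain ⟨a, ha⟩ := hp
      obtain ⟨b, hb⟩ := hq
      exact ⟨a + b, by rw [map_add, ha, hb, map_add]⟩
    | mul_X p c hp =>
      obtain ⟨a, ha⟩ := hp
      by_cases hc : c ∈ F
      · exact ⟨a * X ⟨c, hc⟩, by rw [map_mul, ha, map_mul]; simp [φ]⟩
      · refine ⟨0, ?_⟩
        rw [map_zero, eq_comm, Ideal.Quotient.eq_zero_iff_mem]
        exact Ideal.mul_mem_left _ _ (Ideal.subset_span ⟨c, hc, rfl⟩)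
  have h1 := hdim.trans (ringKrullDim_le_of_surjective φ hφ)
  rw [ringKrullDim_of_isNoetherianRing, ringKrullDim_eq_zero_of_field, zero_add,
    Nat.card_eq_fintype_card, Fintype.card_coe] at h1
  exact_mod_cast h1

/-- The depth of a Stanley–Reisner ring which is an iterated cone over a connected complex with at
least two vertices, and which has a facet with two more vertices than there are apexes. -/
theorem polyDepth_eq (V : Finset (Fin n)) {Δ : Set (Finset (Fin n))}
    {I : Ideal (MvPolynomial (Fin n) K)} (hI : IsFaceIdeal Δ I) (hΔ : IsLowerSet Δ)
    (hV : ∀ c ∈ V, ∀ s ∈ Δ, insert c s ∈ Δ) {c₀ : Fin n} (hc₀ : {c₀} ∈ Δ) (hc₀V : c₀ ∉ V)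
    (hne : ∀ l, ∃ m ≠ l, m ∉ V ∧ {m} ∈ Δ)
    (hconn : ∀ f : Fin n → K, (∀ l m, l ≠ m → l ∉ V → m ∉ V → {l, m} ∈ Δ → f l = f m) →
      ∀ l m, l ∉ V → m ∉ V → {l} ∈ Δ → {m} ∈ Δ → f l = f m)
    (F : Finset (Fin n)) (hF : F ∈ Δ) (hmax : ∀ c ∉ F, insert c F ∉ Δ)
    (hcard : F.card = V.card + 2) :
    polyDepth K n (MvPolynomial (Fin n) K ⧸ I) = ((V.card + 2 : ℕ) : ℕ∞) := by
  refine le_antisymm (iSup_le fun ⟨rs, hrs, hreg⟩ => ?_) ?_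
  · rw [← hcard]
    exact_mod_cast hI.length_le_card_facet F hF hmax hΔ rs hrs hreg.toIsWeaklyRegular
  · obtain ⟨rs, hlen, hrs, hreg⟩ := hI.exists_isWeaklyRegular_of_cone V hV fun J hJ =>
      hJ.exists_isWeaklyRegular_pair (c₀ := c₀)
        (fun s t hts hs => ⟨hΔ hts hs.1, hs.2.mono_right hts⟩)
        ⟨hc₀, Finset.disjoint_singleton_right.2 hc₀V⟩
        (fun l => by
          obtain ⟨m, hml, hmV, hm⟩ := hne l
          exact ⟨m, hml, hm, Finset.disjoint_singleton_right.2 hmV⟩)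
        (fun f hf l m hl hm => hconn f (fun l m hlm hlV hmV h => hf l m hlm
            ⟨h, by simp [hlV, hmV]⟩) l m
          (Finset.disjoint_singleton_right.1 hl.2) (Finset.disjoint_singleton_right.1 hm.2)
          hl.1 hm.1)
    rw [← hlen]
    exact le_iSup (fun rs : {rs : List (MvPolynomial (Fin n) K) //
      (∀ f ∈ rs, f ∈ idealOfVars (Fin n) K) ∧
        RingTheory.Sequence.IsRegular (MvPolynomial (Fin n) K ⧸ I) rs} => (rs.1.length : ℕ∞))
      ⟨rs, hrs, isRegular_of_isWeaklyRegular
        (hI.le_idealOfVars (hΔ (Finset.empty_subset _) hF)) hrs hreg⟩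

end IsFaceIdeal

end StanleyReisner

/-! ### Exactness and minimality of the Taylor complex -/

section Taylor

variable (K : Type*) [Field K] {n r : ℕ} (m : Fin r → Fin n →₀ ℕ)

/-- The direct sum of all the modules of the Taylor complex. -/
abbrev TaylorTotal (K : Type*) [Field K] (n r : ℕ) : Type _ :=
  Finset (Fin r) →₀ MvPolynomial (Fin n) K

/-- The sign with which `e_{s \ {a}}` occurs in the Taylor differential of `e_s`. -/
def taylorSign (s : Finset (Fin r)) (a : Fin r) : K := (-1) ^ (s.filter (· < a)).card

/-- The element `x^(α - lcm(s)) e_s`, of multidegree `α`. -/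
noncomputable def taylorElem (s : Finset (Fin r)) (α : Fin n →₀ ℕ) : TaylorTotal K n r :=
  Finsupp.single s (monomial (α - s.sup m) 1)

/-- The differential of the Taylor complex, on the direct sum of its modules. -/
noncomputable def taylorTotalD : TaylorTotal K n r →ₗ[MvPolynomial (Fin n) K] TaylorTotal K n r :=
  Finsupp.linearCombination _ fun s =>
    ∑ a ∈ s, Finsupp.single (s.erase a)
      ((-1) ^ (s.filter (· < a)).card * monomial (s.sup m - (s.erase a).sup m) (1 : K))

/-- The indices of the monomials that divide `x^α`. -/
def taylorIndices (α : Fin n →₀ ℕ) : Finset (Fin r) := Finset.univ.filter fun a => ∀ c, m a c ≤ α c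

open Classical in
/-- The contracting homotopy of the Taylor complex: in multidegree `α` it adds to the index set
the first monomial that divides `x^α`. -/
noncomputable def taylorHomotopy : TaylorTotal K n r →ₗ[K] TaylorTotal K n r :=
  Finsupp.lsum K fun s => (basisMonomials (Fin n) K).constr K fun u =>
    if h : (taylorIndices m (u + s.sup m)).Nonempty then
      if (taylorIndices m (u + s.sup m)).min' h ∈ s then 0
      else taylorElem K m (insert ((taylorIndices m (u + s.sup m)).min' h) s) (u + s.sup m)
    else 0

variable {K m}

theorem mem_taylorIndices {α : Fin n →₀ ℕ} {a : Fin r} : a ∈ taylorIndices m α ↔ m a ≤ α := by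
  simp [taylorIndices, Finsupp.le_def]

theorem taylorSign_erase_of_lt {s : Finset (Fin r)} {a b : Fin r} (ha : a ∈ s) (hab : a < b) :
    taylorSign K (s.erase a) b = -taylorSign K s b := by
  have h : s.filter (· < b) = insert a ((s.erase a).filter (· < b)) := by
    ext c
    simp only [Finset.mem_filter, Finset.mem_insert, Finset.mem_erase]
    by_cases hc : c = a <;> simp [hc, ha, hab]
  rw [taylorSign, taylorSign, h, Finset.card_insert_of_notMem (by simp), pow_succ]
  ring

theorem taylorSign_erase_of_not_lt {s : Finset (Fin r)} {a b : Fin r} (hab : ¬ a < b) :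
    taylorSign K (s.erase a) b = taylorSign K s b := by
  have h : (s.erase a).filter (· < b) = s.filter (· < b) := by
    ext c
    simp only [Finset.mem_filter, Finset.mem_erase]
    by_cases hc : c = a <;> simp [hc, hab]
  rw [taylorSign, taylorSign, h]

theorem taylorSign_mul_taylorSign_erase {s : Finset (Fin r)} {a b : Fin r} (ha : a ∈ s)
    (hb : b ∈ s) (hab : a ≠ b) :
    taylorSign K s a * taylorSign K (s.erase a) b =
      -(taylorSign K s b * taylorSign K (s.erase b) a) := by
  rcases lt_or_gt_of_ne hab with h | h
  · rw [taylorSign_erase_of_lt ha h, taylorSign_erase_of_not_lt (not_lt.2 h.le)]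
    ring
  · rw [taylorSign_erase_of_lt hb h, taylorSign_erase_of_not_lt (not_lt.2 h.le)]
    ring

theorem neg_one_pow_mul_monomial (k : ℕ) (u : Fin n →₀ ℕ) :
    (-1) ^ k * monomial u (1 : K) = (-1 : K) ^ k • monomial u (1 : K) := by
  rcases neg_one_pow_eq_or K k with h | h <;>
  rcases Nat.even_or_odd k with hk | hk <;> simp [hk.neg_one_pow]

theorem taylorTotalD_taylorElem {s : Finset (Fin r)} {α : Fin n →₀ ℕ} (h : s.sup m ≤ α) :
    taylorTotalD K m (taylorElem K m s α) =
      ∑ a ∈ s, taylorSign K s a • taylorElem K m (s.erase a) α := by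
  rw [taylorTotalD, taylorElem, Finsupp.linearCombination_single, Finset.smul_sum]
  refine Finset.sum_congr rfl fun a _ => ?_
  rw [Finsupp.smul_single, taylorElem, Finsupp.smul_single, neg_one_pow_mul_monomial, smul_eq_mul,
    mul_smul_comm, monomial_mul, one_mul,
    tsub_add_tsub_cancel h (Finset.sup_mono (Finset.erase_subset a s))]
  rfl

theorem taylorTotalD_comp_self (x : TaylorTotal K n r) :
    taylorTotalD K m (taylorTotalD K m x) = 0 := by
  suffices h : taylorTotalD K m ∘ₗ taylorTotalD K m = 0 from LinearMap.congr_fun h x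
  refine Finsupp.lhom_ext' fun s => LinearMap.ext_ring ?_
  have hs : Finsupp.single s (1 : MvPolynomial (Fin n) K) = taylorElem K m s (s.sup m) := by
    rw [taylorElem, tsub_self]
    rfl
  rw [LinearMap.comp_apply, Finsupp.lsingle_apply, hs, LinearMap.comp_apply,
    taylorTotalD_taylorElem le_rfl, map_sum, LinearMap.zero_comp, LinearMap.zero_apply]
  have h1 : ∀ a ∈ s, taylorTotalD K m (taylorSign K s a • taylorElem K m (s.erase a) (s.sup m)) =
      ∑ b ∈ s.erase a, (taylorSign K s a * taylorSign K (s.erase a) b) •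
        taylorElem K m ((s.erase a).erase b) (s.sup m) := fun a _ => by
    rw [LinearMap.map_smul_of_tower,
      taylorTotalD_taylorElem (Finset.sup_mono (Finset.erase_subset a s)), Finset.smul_sum]
    exact Finset.sum_congr rfl fun b _ => smul_smul _ _ _
  rw [Finset.sum_congr rfl h1, Finset.sum_sigma']
  -- Removing `a` then `b` cancels against removing `b` then `a`.
  refine Finset.sum_involution (fun x _ => ⟨x.2, x.1⟩) ?_ ?_ ?_ ?_
  · rintro ⟨a, b⟩ hab
    simp only [Finset.mem_sigma, Finset.mem_erase] at hab
    dsimp only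
    rw [taylorSign_mul_taylorSign_erase hab.1 hab.2.2 hab.2.1.symm, Finset.erase_right_comm,
      neg_smul, neg_add_cancel]
  · rintro ⟨a, b⟩ hab _ h
    simp only [Finset.mem_sigma, Finset.mem_erase] at hab
    exact hab.2.1 (congrArg Sigma.fst h)
  · rintro ⟨a, b⟩ hab
    simp only [Finset.mem_sigma, Finset.mem_erase] at hab ⊢
    exact ⟨hab.2.2, hab.2.1.symm, hab.1⟩
  · rintro ⟨a, b⟩ _
    rfl

theorem taylorHomotopy_taylorElem {s : Finset (Fin r)} {α : Fin n →₀ ℕ} (h : s.sup m ≤ α)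
    (hα : (taylorIndices m α).Nonempty) :
    taylorHomotopy K m (taylorElem K m s α) =
      if (taylorIndices m α).min' hα ∈ s then 0
      else taylorElem K m (insert ((taylorIndices m α).min' hα) s) α := by
  have h1 : monomial (α - s.sup m) (1 : K) = basisMonomials (Fin n) K (α - s.sup m) := by
    rw [coe_basisMonomials]
  rw [taylorHomotopy, taylorElem, Finsupp.lsum_single, h1, Module.Basis.constr_basis]
  simp only [tsub_add_cancel_of_le h, dif_pos hα]

/-- In multidegree `α` the complex is the augmented chain complex of the full simplex on the
monomials dividing `x^α`, and the homotopy is the cone from its least vertex `a₀`. Minimality of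
`a₀` makes its own sign `+1` and makes inserting it reverse every other sign. -/
theorem homotopy_taylorElem {s : Finset (Fin r)} {α : Fin n →₀ ℕ} (h : s.sup m ≤ α)
    (hs : s.Nonempty) :
    taylorTotalD K m (taylorHomotopy K m (taylorElem K m s α)) +
      taylorHomotopy K m (taylorTotalD K m (taylorElem K m s α)) = taylorElem K m s α := by
  have hsα : ∀ a ∈ s, a ∈ taylorIndices m α := fun a ha =>
    mem_taylorIndices.2 ((Finset.le_sup ha).trans h)
  have hα : (taylorIndices m α).Nonempty := hs.mono hsα
  have herase : ∀ a, (s.erase a).sup m ≤ α := fun a =>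
    (Finset.sup_mono (Finset.erase_subset a s)).trans h
  rw [taylorTotalD_taylorElem h, map_sum]
  simp only [map_smul, taylorHomotopy_taylorElem h hα, taylorHomotopy_taylorElem (herase _) hα]
  set a₀ := (taylorIndices m α).min' hα with ha₀
  have hmin : ∀ a ∈ s, a₀ ≤ a := fun a ha => Finset.min'_le _ _ (hsα a ha)
  by_cases h0 : a₀ ∈ s
  · rw [if_pos h0, map_zero, zero_add, Finset.sum_eq_single_of_mem a₀ h0]
    · have : s.filter (· < a₀) = ∅ := Finset.filter_eq_empty_iff.2 fun a ha => not_lt.2 (hmin a ha)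
      rw [if_neg (Finset.notMem_erase _ _), Finset.insert_erase h0, taylorSign, this,
        Finset.card_empty, pow_zero, one_smul]
    · intro a _ ha
      rw [if_pos (Finset.mem_erase.2 ⟨ha.symm, h0⟩), smul_zero]
  · have hins : (insert a₀ s).sup m ≤ α := by
      rw [Finset.sup_insert]
      exact sup_le (mem_taylorIndices.1 (Finset.min'_mem _ _)) h
    rw [if_neg h0, taylorTotalD_taylorElem hins, Finset.sum_insert h0, Finset.erase_insert h0,
      add_assoc, ← Finset.sum_add_distrib, Finset.sum_eq_zero, add_zero]
    · have : (insert a₀ s).filter (· < a₀) = ∅ := Finset.filter_eq_empty_iff.2 fun a ha =>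
        not_lt.2 ((Finset.mem_insert.1 ha).elim (fun h => h.ge) (hmin a))
      rw [taylorSign, this, Finset.card_empty, pow_zero, one_smul]
    · intro a ha
      have ha₀a : a₀ ≠ a := fun h => h0 (h ▸ ha)
      rw [if_neg (fun h => h0 (Finset.mem_of_mem_erase h)), Finset.erase_insert_of_ne ha₀a]
      have h2 := taylorSign_erase_of_lt (K := K) (Finset.mem_insert_self a₀ s)
        (lt_of_le_of_ne (hmin a ha) ha₀a)
      rw [Finset.erase_insert h0] at h2
      rw [h2, neg_smul, add_neg_cancel]

theorem mem_of_taylorElem_mem (W : Submodule K (TaylorTotal K n r)) (A : Set (Finset (Fin r)))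
    (hW : ∀ s ∈ A, ∀ α, s.sup m ≤ α → taylorElem K m s α ∈ W)
    {x : TaylorTotal K n r} (hx : ∀ s ∉ A, x s = 0) : x ∈ W := by
  rw [← x.sum_single]
  refine W.sum_mem fun s hs => ?_
  have hsA : s ∈ A := by
    by_contra h
    exact Finsupp.mem_support_iff.1 hs (hx s h)
  rw [(x s).as_sum, Finsupp.single_finsetSum]
  refine W.sum_mem fun u _ => ?_
  have h1 : Finsupp.single s (monomial u (coeff u (x s))) =
      coeff u (x s) • taylorElem K m s (u + s.sup m) := by
    rw [taylorElem, add_tsub_cancel_right, Finsupp.smul_single, smul_monomial, smul_eq_mul, mul_one]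
  rw [h1]
  exact W.smul_mem _ (hW s hsA _ le_add_self)

/-- The component at `∅` must be excluded: in a multidegree outside the ideal no vertex is available
to cone from. -/
theorem taylor_homotopy {x : TaylorTotal K n r} (hx : x ∅ = 0) :
    taylorTotalD K m (taylorHomotopy K m x) + taylorHomotopy K m (taylorTotalD K m x) = x := by
  let W : Submodule K (TaylorTotal K n r) :=
    { carrier := {x | taylorTotalD K m (taylorHomotopy K m x) +
        taylorHomotopy K m (taylorTotalD K m x) = x}
      add_mem' := fun {x y} (hx : _ = _) (hy : _ = _) => show _ = _ by
        rw [map_add, map_add, map_add, map_add, add_add_add_comm, hx, hy]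
      zero_mem' := show _ = _ by rw [map_zero, map_zero, map_zero, add_zero]
      smul_mem' := fun c x (hx : _ = _) => show _ = _ by
        rw [map_smul, LinearMap.map_smul_of_tower, LinearMap.map_smul_of_tower, map_smul,
          ← smul_add, hx] }
  exact mem_of_taylorElem_mem (m := m) W {s | s.Nonempty}
    (fun s hs α hα => homotopy_taylorElem hα hs)
    (fun s hs => by
      have : s = ∅ := Finset.not_nonempty_iff_eq_empty.1 hs
      rwa [this])

theorem taylorHomotopy_apply_eq_zero {p : ℕ} {x : TaylorTotal K n r}
    (hx : ∀ s, s.card ≠ p → x s = 0) (t : Finset (Fin r)) (ht : t.card ≠ p + 1) :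
    taylorHomotopy K m x t = 0 := by
  let W : Submodule K (TaylorTotal K n r) :=
    { carrier := {x | taylorHomotopy K m x t = 0}
      add_mem' := fun {x y} (hx : _ = 0) (hy : _ = 0) => show _ = 0 by
        rw [map_add, Finsupp.add_apply, hx, hy, add_zero]
      zero_mem' := show _ = 0 by rw [map_zero]; rfl
      smul_mem' := fun c x (hx : _ = 0) => show _ = 0 by
        rw [map_smul, Finsupp.smul_apply, hx, smul_zero] }
  have : x ∈ W := by
    refine mem_of_taylorElem_mem (m := m) W {s | s.card = p} (fun s hs α hα => ?_) hx
    change taylorHomotopy K m (taylorElem K m s α) t = 0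
    have hs : s.card = p := hs
    by_cases h : (taylorIndices m α).Nonempty
    · rw [taylorHomotopy_taylorElem hα h]
      split_ifs with h0
      · rfl
      · refine Finsupp.single_eq_of_ne fun hst => ht ?_
        rw [hst, Finset.card_insert_of_notMem h0, hs]
    · have h1 : monomial (α - s.sup m) (1 : K) = basisMonomials (Fin n) K (α - s.sup m) := by
        rw [coe_basisMonomials]
      rw [taylorHomotopy, taylorElem, Finsupp.lsum_single, h1, Module.Basis.constr_basis]
      simp only [tsub_add_cancel_of_le hα, dif_neg h, Finsupp.coe_zero, Pi.zero_apply]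
  exact this

/-- The inclusion of a module of the Taylor complex into their direct sum. -/
noncomputable def taylorInclusion (K : Type*) [Field K] (n r p : ℕ) :
    TaylorModule K n r p →ₗ[MvPolynomial (Fin n) K] TaylorTotal K n r :=
  Finsupp.lmapDomain _ _ Subtype.val

theorem taylorInclusion_injective (p : ℕ) : Function.Injective (taylorInclusion K n r p) :=
  Finsupp.mapDomain_injective Subtype.val_injective

theorem taylorInclusion_apply_eq_zero {p : ℕ} (x : TaylorModule K n r p) (s : Finset (Fin r))
    (hs : s.card ≠ p) : taylorInclusion K n r p x s = 0 :=
  Finsupp.mapDomain_of_notMem_range x s fun ⟨t, ht⟩ => hs (ht ▸ t.2)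

theorem exists_taylorInclusion_eq {p : ℕ} {x : TaylorTotal K n r}
    (hx : ∀ s, s.card ≠ p → x s = 0) : ∃ y, taylorInclusion K n r p y = x :=
  ⟨x.comapDomain Subtype.val Subtype.val_injective.injOn,
    Finsupp.mapDomain_comapDomain _ Subtype.val_injective _ fun s hs => ⟨⟨s, by
      by_contra h
      exact Finsupp.mem_support_iff.1 hs (hx s h)⟩, rfl⟩⟩

theorem taylorTotalD_taylorInclusion (p : ℕ) (x : TaylorModule K n r (p + 1)) :
    taylorTotalD K m (taylorInclusion K n r (p + 1) x) =
      taylorInclusion K n r p (taylorD K m p x) := by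
  suffices h : taylorTotalD K m ∘ₗ taylorInclusion K n r (p + 1) =
      taylorInclusion K n r p ∘ₗ taylorD K m p from LinearMap.congr_fun h x
  refine Finsupp.lhom_ext' fun s => LinearMap.ext_ring ?_
  simp only [LinearMap.comp_apply, Finsupp.lsingle_apply, taylorInclusion,
    Finsupp.lmapDomain_apply, Finsupp.mapDomain_single, taylorTotalD, taylorD,
    Finsupp.linearCombination_single, one_smul, Finsupp.mapDomain_finsetSum]
  exact (Finset.sum_attach s.1 fun a => Finsupp.single (s.1.erase a)
    ((-1) ^ (s.1.filter (· < a)).card * monomial (s.1.sup m - (s.1.erase a).sup m) (1 : K))).symm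

theorem taylorD_exact (p : ℕ) : Function.Exact (taylorD K m (p + 1)) (taylorD K m p) := by
  intro y
  constructor
  · intro hy
    have h1 : taylorTotalD K m (taylorInclusion K n r (p + 1) y) = 0 := by
      rw [taylorTotalD_taylorInclusion, hy, map_zero]
    have h2 := taylor_homotopy (m := m) (taylorInclusion_apply_eq_zero y ∅ (by simp))
    rw [h1, map_zero, add_zero] at h2
    obtain ⟨x, hx⟩ := exists_taylorInclusion_eq
      (taylorHomotopy_apply_eq_zero (m := m) (taylorInclusion_apply_eq_zero y))
    exact ⟨x, taylorInclusion_injective _ (by rw [← taylorTotalD_taylorInclusion, hx, h2])⟩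
  · rintro ⟨x, rfl⟩
    apply taylorInclusion_injective
    rw [← taylorTotalD_taylorInclusion, ← taylorTotalD_taylorInclusion, taylorTotalD_comp_self,
      map_zero]

theorem taylorD_zero_single (a : Fin r) :
    taylorD K m 0 (Finsupp.single ⟨{a}, Finset.card_singleton a⟩ 1) =
      Finsupp.single ⟨∅, Finset.card_empty⟩ (monomial (m a) 1) := by
  apply taylorInclusion_injective
  rw [← taylorTotalD_taylorInclusion]
  rw [taylorInclusion, Finsupp.lmapDomain_apply, Finsupp.mapDomain_single, taylorInclusion,
    Finsupp.lmapDomain_apply, Finsupp.mapDomain_single, taylorTotalD,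
    Finsupp.linearCombination_single, one_smul, Finset.sum_singleton, Finset.erase_singleton,
    Finset.filter_singleton, if_neg (lt_irrefl a), Finset.card_empty, pow_zero, one_mul,
    Finset.sup_singleton, Finset.sup_empty, bot_eq_zero, tsub_zero]

theorem taylorD_exact_augmentation (I : Ideal (MvPolynomial (Fin n) K))
    (hI : I = Ideal.span (Set.range fun a => monomial (m a) (1 : K))) :
    Function.Exact (taylorD K m 0) (taylorAugmentation r I) := by
  have hempty : ∀ s : {s : Finset (Fin r) // s.card = 0}, s = ⟨∅, Finset.card_empty⟩ :=
    fun s => Subtype.ext (Finset.card_eq_zero.1 s.2)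
  have hsingle : ∀ y : TaylorModule K n r 0,
      y = Finsupp.single ⟨∅, Finset.card_empty⟩ (y ⟨∅, Finset.card_empty⟩) := fun y => by
    ext1 s
    rw [hempty s, Finsupp.single_eq_same]
  have hε : ∀ y, taylorAugmentation r I y = 0 ↔ y ⟨∅, Finset.card_empty⟩ ∈ I := fun y => by
    rw [taylorAugmentation, LinearMap.comp_apply, Submodule.mkQ_apply,
      Submodule.Quotient.mk_eq_zero, Finsupp.lapply_apply]
  intro y
  rw [hε]
  constructor
  · intro hy
    have hle : I ≤ (LinearMap.range (taylorD K m 0)).comap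
        (Finsupp.lsingle ⟨∅, Finset.card_empty⟩) := by
      rw [hI]
      refine Ideal.span_le.2 ?_
      rintro _ ⟨a, rfl⟩
      exact ⟨_, taylorD_zero_single a⟩
    rw [hsingle y]
    exact hle hy
  · rintro ⟨x, rfl⟩
    rw [← hε]
    suffices h : taylorAugmentation r I ∘ₗ taylorD K m 0 = 0 from LinearMap.congr_fun h x
    refine Finsupp.lhom_ext' fun s => LinearMap.ext_ring ?_
    obtain ⟨a, ha⟩ := Finset.card_eq_one.1 s.2
    have hs : s = ⟨{a}, Finset.card_singleton a⟩ := Subtype.ext ha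
    rw [LinearMap.comp_apply, LinearMap.comp_apply, Finsupp.lsingle_apply, hs, taylorD_zero_single]
    refine (hε _).2 ?_
    rw [Finsupp.single_eq_same, hI]
    exact Ideal.subset_span ⟨a, rfl⟩

/-- A variable dividing only the generator `m a` divides `lcm(s)` but not `lcm(s \ {a})`, so no
coefficient of the differential is a unit. -/
theorem taylor_isMinimalFreeResolution (I : Ideal (MvPolynomial (Fin n) K))
    (hI : I = Ideal.span (Set.range fun a => monomial (m a) (1 : K)))
    (hm : ∀ a, ∃ c, m a c ≠ 0 ∧ ∀ b ≠ a, m b c = 0) :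
    IsMinimalFreeResolution (idealOfVars (Fin n) K) (TaylorModule K n r) (taylorD K m)
      (taylorAugmentation r I) where
  free _ := inferInstance
  finite _ := inferInstance
  surjective := (Submodule.mkQ_surjective I).comp fun q =>
    ⟨Finsupp.single _ q, by rw [Finsupp.lapply_apply, Finsupp.single_eq_same]⟩
  exact_zero := taylorD_exact_augmentation I hI
  exact_succ := taylorD_exact
  minimal p := by
    rw [taylorD, Finsupp.range_linearCombination, Submodule.span_le]
    rintro _ ⟨s, rfl⟩
    refine Submodule.sum_mem _ fun a _ => ?_
    rw [← mul_one (_ * _), ← smul_eq_mul, ← Finsupp.smul_single]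
    refine Submodule.smul_mem_smul (Ideal.mul_mem_left _ _ ?_) Submodule.mem_top
    rw [mem_idealOfVars_iff_coeff_zero, coeff_monomial, if_neg]
    intro h
    obtain ⟨c, hc, hcb⟩ := hm a.1
    have h1 : (s.1.sup m - (s.1.erase a.1).sup m) c = 0 := by rw [h]; rfl
    have h2 : ((s.1.erase a.1).sup m) c = 0 := by
      refine Finset.sup_induction (p := fun w : Fin n →₀ ℕ => w c = 0) rfl
        (fun u hu v hv => ?_) fun b hb => hcb b (Finset.ne_of_mem_erase hb)
      rw [Finsupp.sup_apply, hu, hv, sup_idem]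
    have h3 : m a.1 c ≤ s.1.sup m c := Finset.le_sup (f := m) a.2 c
    rw [Finsupp.tsub_apply, h2, tsub_zero] at h1
    omega

theorem projectiveDimension_of_taylor (I : Ideal (MvPolynomial (Fin n) K))
    (hI : I = Ideal.span (Set.range fun a => monomial (m a) (1 : K)))
    (hm : ∀ a, ∃ c, m a c ≠ 0 ∧ ∀ b ≠ a, m b c = 0) :
    CategoryTheory.projectiveDimension
      (ModuleCat.of (MvPolynomial (Fin n) K) (MvPolynomial (Fin n) K ⧸ I)) = r := by
  refine (taylor_isMinimalFreeResolution I hI hm).projectiveDimension_eq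
    (idealOfVars_isPrime.ne_top) r ?_ ?_
  · have : Nonempty {s : Finset (Fin r) // s.card = r} := ⟨⟨Finset.univ, by simp⟩⟩
    infer_instance
  · have : IsEmpty {s : Finset (Fin r) // s.card = r + 1} := ⟨fun s => by
      have := s.1.card_le_univ
      rw [s.2, Fintype.card_fin] at this
      omega⟩
    infer_instance

end Taylor

/-! ### The lexsegment graph and its independence complex -/

section Lexsegment

theorem edge_apply {n : ℕ} (a b : ℕ) (c : Fin n) :
    edge n a b c = if (c : ℕ) + 1 = a ∨ (c : ℕ) + 1 = b then 1 else 0 := rfl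

theorem edge_eq_single_add_single {n : ℕ} {x y : Fin n} (h : x ≠ y) :
    edge n (x + 1) (y + 1) = Finsupp.single x 1 + Finsupp.single y 1 := by
  ext c
  rw [edge_apply, Finsupp.add_apply, Finsupp.single_apply, Finsupp.single_apply]
  have h' : (x : ℕ) ≠ y := fun hxy => h (Fin.ext hxy)
  simp only [Fin.ext_iff]
  split_ifs <;> omega

theorem edge_lex_lt {n a b c d : ℕ} (hc : 1 ≤ c) (hcd : c < d) (hd : d ≤ n) (hab : a < b)
    (h : c < a ∨ c = a ∧ d < b) : toLex (edge n a b) < toLex (edge n c d) := by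
  rcases h with h | ⟨rfl, h⟩
  · refine Finsupp.Lex.lt_iff.2 ⟨⟨c - 1, by omega⟩, fun x hx => ?_, ?_⟩
    · change edge n a b x = edge n c d x
      have : (x : ℕ) < c - 1 := hx
      rw [edge_apply, edge_apply, if_neg (by omega), if_neg (by omega)]
    · change edge n a b _ < edge n c d _
      rw [edge_apply, edge_apply, if_neg (by dsimp only; omega), if_pos (by dsimp only; omega)]
      exact one_pos
  · refine Finsupp.Lex.lt_iff.2 ⟨⟨d - 1, by omega⟩, fun x hx => ?_, ?_⟩
    · change edge n c b x = edge n c d x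
      have : (x : ℕ) < d - 1 := hx
      rw [edge_apply, edge_apply]
      split_ifs <;> omega
    · change edge n c b _ < edge n c d _
      rw [edge_apply, edge_apply, if_neg (by dsimp only; omega), if_pos (by dsimp only; omega)]
      exact one_pos

theorem edge_lex_lt_iff {n a b c d : ℕ} (ha : 1 ≤ a) (hab : a < b) (hb : b ≤ n) (hc : 1 ≤ c)
    (hcd : c < d) (hd : d ≤ n) :
    toLex (edge n a b) < toLex (edge n c d) ↔ c < a ∨ c = a ∧ d < b := by
  refine ⟨fun h => ?_, edge_lex_lt hc hcd hd hab⟩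
  by_contra hcon
  by_cases heq : a = c ∧ b = d
  · obtain ⟨rfl, rfl⟩ := heq
    exact lt_irrefl _ h
  · exact lt_asymm h (edge_lex_lt ha hab hb hcd (by omega))

theorem edge_lex_le_iff {n a b c d : ℕ} (ha : 1 ≤ a) (hab : a < b) (hb : b ≤ n) (hc : 1 ≤ c)
    (hcd : c < d) (hd : d ≤ n) :
    toLex (edge n a b) ≤ toLex (edge n c d) ↔ c < a ∨ c = a ∧ d ≤ b := by
  rw [← not_lt, edge_lex_lt_iff hc hcd hd ha hab hb]
  omega

theorem exists_eq_edge {n : ℕ} {w : Fin n →₀ ℕ} (hw : ∀ c, w c ≤ 1) (hdeg : w.degree = 2) :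
    ∃ x y : Fin n, x < y ∧ w = edge n (x + 1) (y + 1) := by
  have h1 : ∀ c ∈ w.support, w c = 1 := fun c hc => by
    have := Finsupp.mem_support_iff.1 hc
    have := hw c
    omega
  have hcard : w.support.card = 2 := by
    rw [← hdeg, Finsupp.degree_apply, Finset.card_eq_sum_ones]
    exact Finset.sum_congr rfl fun c hc => (h1 c hc).symm
  obtain ⟨x, y, hxy, hs⟩ := Finset.card_eq_two.1 hcard
  have key : ∀ x y : Fin n, w.support = {x, y} → w = edge n (x + 1) (y + 1) := by
    intro x y hs
    ext c
    rw [edge_apply]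
    simp only [add_left_inj, ← Fin.ext_iff]
    split_ifs with hc
    · exact h1 c (by rw [hs]; simpa using hc)
    · exact Finsupp.notMem_support_iff.1 (by rw [hs]; simpa using hc)
  rcases lt_or_gt_of_ne hxy with h | h
  · exact ⟨x, y, h, key x y hs⟩
  · exact ⟨y, x, h, key y x (by rw [hs, Finset.pair_comm])⟩

/-- The edges `{a, b}`, `a < b`, of the graph with edge ideal `(L(x_1 x_i, x_j x_k))`. -/
def LexEdge (i j k a b : ℕ) : Prop := (a < j ∨ a = j ∧ b ≤ k) ∧ (1 < a ∨ i ≤ b)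

variable {n i j k : ℕ}

theorem mem_lexsegment_iff (hi : 2 ≤ i) (hin : i ≤ n) (hj : 2 ≤ j) (hjk : j < k) (hkn : k ≤ n)
    {w : Fin n →₀ ℕ} : w ∈ lexsegment (edge n 1 i) (edge n j k) ↔
      ∃ x y : Fin n, x < y ∧ LexEdge i j k (x + 1) (y + 1) ∧ w = edge n (x + 1) (y + 1) := by
  have hle : ∀ x y : Fin n, x < y → ((toLex (edge n j k) ≤ toLex (edge n (x + 1) (y + 1)) ∧
      toLex (edge n (x + 1) (y + 1)) ≤ toLex (edge n 1 i)) ↔ LexEdge i j k (x + 1) (y + 1)) := by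
    intro x y hxy
    have hxy' : (x : ℕ) < y := hxy
    rw [edge_lex_le_iff (by omega) hjk hkn (by omega) (by omega) (by omega),
      edge_lex_le_iff (by omega) (by omega) (by omega) le_rfl (by omega) hin, LexEdge]
    omega
  constructor
  · rintro ⟨h1, h2, h3, h4⟩
    obtain ⟨x, y, hxy, rfl⟩ := exists_eq_edge h1 h2
    exact ⟨x, y, hxy, (hle x y hxy).1 ⟨h3, h4⟩, rfl⟩
  · rintro ⟨x, y, hxy, hE, rfl⟩
    refine ⟨fun c => ?_, ?_, (hle x y hxy).2 hE⟩
    · rw [edge_apply]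
      split_ifs <;> omega
    · rw [edge_eq_single_add_single hxy.ne, map_add, Finsupp.degree_single, Finsupp.degree_single]

theorem edge_le_iff {x y : Fin n} {u : Fin n →₀ ℕ} :
    edge n (x + 1) (y + 1) ≤ u ↔ x ∈ u.support ∧ y ∈ u.support := by
  rw [Finsupp.mem_support_iff, Finsupp.mem_support_iff]
  constructor
  · intro h
    have hx := h x
    have hy := h y
    rw [edge_apply, if_pos (Or.inl rfl)] at hx
    rw [edge_apply, if_pos (Or.inr rfl)] at hy
    omega
  · rintro ⟨hx, hy⟩ c
    rw [edge_apply]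
    split_ifs with h
    · simp only [add_left_inj, ← Fin.ext_iff] at h
      rcases h with rfl | rfl <;> omega
    · exact Nat.zero_le _

/-- The independent sets of the graph with edge ideal `(L(x_1 x_i, x_j x_k))`. -/
def lexIndependent (n i j k : ℕ) : Set (Finset (Fin n)) :=
  {s | ∀ x ∈ s, ∀ y ∈ s, x < y → ¬ LexEdge i j k (x + 1) (y + 1)}

theorem isFaceIdeal_lexsegmentEdgeIdeal (K : Type*) [Field K] (hi : 2 ≤ i) (hin : i ≤ n)
    (hj : 2 ≤ j) (hjk : j < k) (hkn : k ≤ n) :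
    IsFaceIdeal (lexIndependent n i j k)
      (lexsegmentEdgeIdeal K (edge n 1 i) (edge n j k)) := by
  intro p
  rw [lexsegmentEdgeIdeal, mem_ideal_span_monomial_image]
  refine forall_congr' fun u => ?_
  rw [mem_support_iff, ← not_imp_not, not_not]
  refine imp_congr_left ?_
  push Not
  simp only [mem_lexsegment_iff hi hin hj hjk hkn]
  constructor
  · intro h x hx y hy hxy hE
    exact h _ ⟨x, y, hxy, hE, rfl⟩ (edge_le_iff.2 ⟨hx, hy⟩)
  · rintro h _ ⟨x, y, hxy, hE, rfl⟩ hle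
    exact h x (edge_le_iff.1 hle).1 y (edge_le_iff.1 hle).2 hxy hE

theorem isLowerSet_lexIndependent : IsLowerSet (lexIndependent n i j k) :=
  fun _ _ hts hs x hx y hy => hs x (hts hx) y (hts hy)

theorem pair_mem_lexIndependent {x y : Fin n} (hxy : x < y)
    (h : ¬ LexEdge i j k (x + 1) (y + 1)) : {x, y} ∈ lexIndependent n i j k := by
  intro a ha b hb hab
  simp only [Finset.mem_insert, Finset.mem_singleton] at ha hb
  rcases ha with rfl | rfl <;> rcases hb with rfl | rfl
  · exact absurd hab (lt_irrefl _)
  · exact h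
  · exact absurd hab hxy.asymm
  · exact absurd hab (lt_irrefl _)

theorem singleton_mem_lexIndependent (x : Fin n) : {x} ∈ lexIndependent n i j k := by
  intro a ha b hb hab
  rw [Finset.mem_singleton.1 ha, Finset.mem_singleton.1 hb] at hab
  exact absurd hab (lt_irrefl _)

theorem polyDepth_lexsegmentEdgeIdeal (K : Type*) [Field K] (hin : i ≤ n)
    (hj : 2 ≤ j) (hjk : j < k) (hkn : k ≤ n) (hij : j + 1 < i ∨ j + 1 = i ∧ k < n)
    (V : Finset (Fin n)) (hV : ∀ c : Fin n, c ∈ V ↔ j = 2 ∧ k < (c : ℕ) + 1 ∧ (c : ℕ) + 1 < i) :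
    polyDepth K n (MvPolynomial (Fin n) K ⧸ lexsegmentEdgeIdeal K (edge n 1 i) (edge n j k)) =
      ((V.card + 2 : ℕ) : ℕ∞) := by
  have hI := isFaceIdeal_lexsegmentEdgeIdeal K (by omega) hin hj hjk hkn
  have hv : ∀ a, 1 ≤ a → a ≤ n → ∃ x : Fin n, (x : ℕ) + 1 = a := fun a h1 h2 =>
    ⟨⟨a - 1, by omega⟩, Nat.sub_add_cancel h1⟩
  obtain ⟨o, ho⟩ := hv 1 le_rfl (by omega)
  obtain ⟨t, ht⟩ := hv 2 (by omega) (by omega)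
  have hot : o ≠ t := fun h => by rw [h] at ho; omega
  have hoV : o ∉ V := by rw [hV]; omega
  have htV : t ∉ V := by rw [hV]; omega
  -- Here `o` and `t` are the vertices `1` and `2`; the facet is `{1, 2} ∪ V`.
  refine hI.polyDepth_eq V isLowerSet_lexIndependent ?_
    (singleton_mem_lexIndependent o) hoV ?_ ?_ (insert o (insert t V)) ?_ ?_ ?_
  · intro c hc s hs x hx y hy hxy
    rw [hV] at hc
    have hxy' : (x : ℕ) < y := hxy
    rcases Finset.mem_insert.1 hx with rfl | hx
    · rw [LexEdge]; omega
    · rcases Finset.mem_insert.1 hy with rfl | hy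
      · rw [LexEdge]; omega
      · exact hs x hx y hy hxy
  · intro l
    by_cases h : l = o
    · exact ⟨t, by rw [h]; exact hot.symm, htV, singleton_mem_lexIndependent t⟩
    · exact ⟨o, Ne.symm h, hoV, singleton_mem_lexIndependent o⟩
  · intro f hf
    have hlt : ∀ x y : Fin n, x < y → x ∉ V → y ∉ V → ¬ LexEdge i j k (x + 1) (y + 1) →
        f x = f y := fun x y hxy hx hy h => hf x y hxy.ne hx hy (pair_mem_lexIndependent hxy h)
    have hsmall : ∀ x : Fin n, x ∉ V → (x : ℕ) + 1 < i → f o = f x := by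
      intro x hx hxi
      by_cases h : o = x
      · rw [h]
      · have h' : (o : ℕ) ≠ x := fun hox => h (Fin.ext hox)
        exact hlt o x (Fin.lt_def.2 (by omega)) hoV hx (by rw [LexEdge]; omega)
    have hall : ∀ x : Fin n, x ∉ V → f o = f x := by
      intro x hx
      by_cases hxi : (x : ℕ) + 1 < i
      · exact hsmall x hx hxi
      -- Vertex `1` is joined in the complex to all others below `i`. A vertex `x ≥ i` is reached
      -- through `j + 1` if `j + 1 < i`, since no edge has smaller endpoint above `j`. If `j + 1 =
      -- i`, the path is `1, j, n, x`, where `{j, n}` is a non-edge because `k < n`.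
      · rcases hij with hij | ⟨hij, hkn'⟩
        · obtain ⟨y, hy⟩ := hv (j + 1) (by omega) (by omega)
          have hyV : y ∉ V := by rw [hV]; omega
          rw [hsmall y hyV (by omega)]
          exact hlt y x (Fin.lt_def.2 (by omega)) hyV hx (by rw [LexEdge]; omega)
        · obtain ⟨y, hy⟩ := hv j (by omega) (by omega)
          obtain ⟨z, hz⟩ := hv n (by omega) (by omega)
          have hyV : y ∉ V := by rw [hV]; omega
          have hzV : z ∉ V := by rw [hV]; omega
          rw [hsmall y hyV (by omega),
            hlt y z (Fin.lt_def.2 (by omega)) hyV hzV (by rw [LexEdge]; omega)]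
          by_cases h : x = z
          · rw [h]
          · have h' : (x : ℕ) ≠ z := fun hxz => h (Fin.ext hxz)
            exact (hlt x z (Fin.lt_def.2 (by omega)) hx hzV (by rw [LexEdge]; omega)).symm
    intro l m hl hm _ _
    rw [← hall l hl, ← hall m hm]
  · intro x hx y hy hxy
    have hxy' : (x : ℕ) < y := hxy
    simp only [Finset.mem_insert, hV, Fin.ext_iff] at hx hy
    rw [LexEdge]
    omega
  · intro c hc h
    simp only [Finset.mem_insert, hV, Fin.ext_iff] at hc
    -- Maximality of the facet: a vertex beyond both `i - 1` and `k` is adjacent to `1`, and any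
    -- other vertex outside the facet is adjacent to `2`.
    by_cases hic : i ≤ (c : ℕ) + 1 ∧ ¬ ((c : ℕ) + 1 ≤ k)
    · exact h o (by simp) c (by simp) (Fin.lt_def.2 (by omega)) (by rw [LexEdge]; omega)
    · exact h t (by simp) c (by simp) (Fin.lt_def.2 (by omega)) (by rw [LexEdge]; omega)
  · rw [Finset.card_insert_of_notMem (by simp [hot, hoV]), Finset.card_insert_of_notMem htV]

theorem minimalMonomialGenerators_lexsegmentEdgeIdeal (K : Type*) [Field K] (u v : Fin n →₀ ℕ) :
    minimalMonomialGenerators (lexsegmentEdgeIdeal K u v) = lexsegment u v := by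
  have hmem : ∀ w : Fin n →₀ ℕ, monomial w (1 : K) ∈ lexsegmentEdgeIdeal K u v ↔
      ∃ e ∈ lexsegment u v, e ≤ w := fun w => by
    rw [lexsegmentEdgeIdeal, mem_ideal_span_monomial_image]
    simp
  ext w
  constructor
  · rintro ⟨hw, hmin⟩
    obtain ⟨e, he, hew⟩ := (hmem w).1 hw
    rwa [le_antisymm (hmin ((hmem e).2 ⟨e, he, le_rfl⟩) hew) hew]
  · intro hw
    refine ⟨(hmem w).2 ⟨w, hw, le_rfl⟩, fun y hy hyw => ?_⟩
    obtain ⟨e, he, hey⟩ := (hmem y).1 hy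
    -- All generators have degree two, so none properly divides another.
    have h1 : (w - e).degree = 0 := by
      have := congrArg Finsupp.degree (tsub_add_cancel_of_le (hey.trans hyw))
      rw [map_add, he.2.1, hw.2.1] at this
      omega
    rw [Finsupp.degree_eq_zero_iff, tsub_eq_zero_iff_le] at h1
    exact h1.trans hey

/-- For `j = 2` and `k < i` every edge is determined by its larger endpoint. -/
theorem exists_private_variable (hin : i ≤ n) (hk : 2 < k) (hki : k < i) {w : Fin n →₀ ℕ}
    (hw : w ∈ lexsegment (edge n 1 i) (edge n 2 k)) :
    ∃ c, w c ≠ 0 ∧ ∀ w' ∈ lexsegment (edge n 1 i) (edge n 2 k), w' ≠ w → w' c = 0 := by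
  rw [mem_lexsegment_iff (by omega) hin le_rfl hk (by omega)] at hw
  obtain ⟨x, y, hxy, hE, rfl⟩ := hw
  have hxy' : (x : ℕ) < y := hxy
  refine ⟨y, by rw [edge_apply, if_pos (Or.inr rfl)]; exact one_ne_zero, fun w' hw' hne => ?_⟩
  rw [mem_lexsegment_iff (by omega) hin le_rfl hk (by omega)] at hw'
  obtain ⟨x', y', hxy2, hE', rfl⟩ := hw'
  have hxy2' : (x' : ℕ) < y' := hxy2
  rw [edge_apply, if_neg]
  intro h
  rw [LexEdge] at hE hE'
  apply hne
  have h1 : (x' : ℕ) = x := by omega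
  have h2 : (y' : ℕ) = y := by omega
  rw [h1, h2]

theorem exists_private_variable_of_range_eq (hin : i ≤ n) (hk : 2 < k) (hki : k < i) {r : ℕ}
    {m : Fin r → Fin n →₀ ℕ} (hm : Function.Injective m)
    (hrange : Set.range m = lexsegment (edge n 1 i) (edge n 2 k)) (a : Fin r) :
    ∃ c, m a c ≠ 0 ∧ ∀ b ≠ a, m b c = 0 := by
  obtain ⟨c, hc, hcb⟩ := exists_private_variable hin hk hki (hrange ▸ Set.mem_range_self a)
  exact ⟨c, hc, fun b hb => hcb _ (hrange ▸ Set.mem_range_self b) (hm.ne hb)⟩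

theorem lexsegmentEdgeIdeal_eq_span_range {K : Type*} [Field K] {r : ℕ} {m : Fin r → Fin n →₀ ℕ}
    {u v : Fin n →₀ ℕ} (hrange : Set.range m = lexsegment u v) :
    lexsegmentEdgeIdeal K u v = Ideal.span (Set.range fun a => monomial (m a) (1 : K)) := by
  rw [lexsegmentEdgeIdeal, ← hrange, ← Set.range_comp]
  rfl

theorem ncard_lexsegment (hin : i ≤ n) (hk : 2 < k) (hki : k < i) :
    (lexsegment (edge n 1 i) (edge n 2 k)).ncard = n + k - i - 1 := by
  -- Edges are counted by their larger endpoint `b`: it is paired with `2` for `3 ≤ b ≤ k` and with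
  -- `1` for `i ≤ b ≤ n`.
  let A : Finset ℕ := Finset.Icc 3 k ∪ Finset.Icc i n
  let g : ℕ → Fin n →₀ ℕ := fun b => edge n (if b < i then 2 else 1) b
  have hg : lexsegment (edge n 1 i) (edge n 2 k) = g '' A := by
    ext w
    rw [mem_lexsegment_iff (by omega) hin le_rfl hk (by omega)]
    constructor
    · rintro ⟨x, y, hxy, hE, rfl⟩
      have hxy' : (x : ℕ) < y := hxy
      rw [LexEdge] at hE
      refine ⟨y + 1, ?_, ?_⟩
      · simp only [A, Finset.coe_union, Finset.coe_Icc, Set.mem_union, Set.mem_Icc]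
        omega
      · change edge n _ _ = _
        congr 1
        split_ifs <;> omega
    · rintro ⟨b, hb, rfl⟩
      simp only [A, Finset.coe_union, Finset.coe_Icc, Set.mem_union, Set.mem_Icc] at hb
      refine ⟨⟨(if b < i then 2 else 1) - 1, by split_ifs <;> omega⟩, ⟨b - 1, by omega⟩, ?_, ?_, ?_⟩
      · rw [Fin.lt_def]
        dsimp only
        split_ifs <;> omega
      · rw [LexEdge]
        dsimp only
        split_ifs <;> omega
      · change edge n _ _ = edge n _ _
        congr 1
        · split_ifs <;> rfl
        · dsimp only
          omega
  have hinj : Set.InjOn g A := by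
    intro b hb b' hb' h
    simp only [A, Finset.coe_union, Finset.coe_Icc, Set.mem_union, Set.mem_Icc] at hb hb'
    -- Read off the exponent of `x_b`: since `b ≥ 3`, it cannot be the smaller endpoint of the other
    -- edge.
    have h1 := DFunLike.congr_fun h (⟨b - 1, by omega⟩ : Fin n)
    change edge n _ _ _ = edge n _ _ _ at h1
    rw [edge_apply, edge_apply, if_pos (by dsimp only; omega)] at h1
    split_ifs at h1 <;> simp_all <;> omega
  rw [hg, hinj.ncard_image, Set.ncard_coe_finset, Finset.card_union_of_disjoint,
    Nat.card_Icc, Nat.card_Icc]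
  · omega
  · rw [Finset.disjoint_left]
    intro b hb hb'
    rw [Finset.mem_Icc] at hb hb'
    omega

end Lexsegment

/-! ### The main theorem -/

theorem lemma1p6 {K : Type*} [Field K] (n i j k : ℕ)
    (hi : 2 ≤ i) (hin : i ≤ n) (hj : 2 ≤ j) (hjk : j < k) (hkn : k ≤ n)
    (I : Ideal (MvPolynomial (Fin n) K))
    (hI : I = lexsegmentEdgeIdeal K (edge n 1 i) (edge n j k))
    (hv : toLex (edge n (i - 1) n) < toLex (edge n j k)) :
    (3 ≤ j → polyDepth K n (MvPolynomial (Fin n) K ⧸ I) = 2) ∧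
    (j = 2 → i ≤ k → polyDepth K n (MvPolynomial (Fin n) K ⧸ I) = 2) ∧
    (j = 2 → k < i →
      polyDepth K n (MvPolynomial (Fin n) K ⧸ I) = ((i + 1 - k : ℕ) : ℕ∞) ∧
      (∀ (r : ℕ) (m : Fin r → Fin n →₀ ℕ), Function.Injective m →
        Set.range m = minimalMonomialGenerators I →
        IsMinimalFreeResolution (MvPolynomial.idealOfVars (Fin n) K)
          (TaylorModule K n r) (taylorD K m) (taylorAugmentation r I)) ∧
      CategoryTheory.projectiveDimension
          (ModuleCat.of (MvPolynomial (Fin n) K) (MvPolynomial (Fin n) K ⧸ I)) =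
        ((minimalMonomialGenerators I).ncard : WithBot ℕ∞) ∧
      (minimalMonomialGenerators I).ncard = n + k - i - 1) := by
  have hij : j + 1 < i ∨ j + 1 = i ∧ k < n := by
    rw [edge_lex_lt_iff (by omega) (by omega) le_rfl (by omega) hjk hkn] at hv
    omega
  -- The cone points: `V` is empty unless `j = 2` and `k + 1 < i`, and for `j = 2`, `k < i` it has
  -- `i - 1 - k` elements.
  let V : Finset (Fin n) :=
    Finset.univ.filter fun c => j = 2 ∧ k < (c : ℕ) + 1 ∧ (c : ℕ) + 1 < i
  have hV : ∀ c : Fin n, c ∈ V ↔ j = 2 ∧ k < (c : ℕ) + 1 ∧ (c : ℕ) + 1 < i := by simp [V]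
  have hdepth := polyDepth_lexsegmentEdgeIdeal K hin hj hjk hkn hij V hV
  rw [← hI] at hdepth
  refine ⟨fun h3 => ?_, fun h2 hik => ?_, fun h2 hki => ⟨?_, ?_, ?_, ?_⟩⟩
  · have : V = ∅ := Finset.eq_empty_of_forall_notMem fun c hc => by rw [hV] at hc; omega
    simpa [this] using hdepth
  · have : V = ∅ := Finset.eq_empty_of_forall_notMem fun c hc => by rw [hV] at hc; omega
    simpa [this] using hdepth
  · have hcard : V.card = i - 1 - k := by
      have : V.map Fin.valEmbedding = Finset.Ico k (i - 1) := by
        ext b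
        simp only [Finset.mem_map, hV, Fin.valEmbedding_apply, Finset.mem_Ico]
        constructor
        · rintro ⟨c, hc, rfl⟩
          omega
        · intro hb
          exact ⟨⟨b, by omega⟩, by dsimp only; omega, rfl⟩
      rw [← Finset.card_map Fin.valEmbedding, this, Nat.card_Ico]
    rw [hdepth, hcard]
    congr 1
    omega
  all_goals
    subst h2 hI
    rw [minimalMonomialGenerators_lexsegmentEdgeIdeal]
  · intro r m hm hrange
    exact taylor_isMinimalFreeResolution _ (lexsegmentEdgeIdeal_eq_span_range hrange)
      (exists_private_variable_of_range_eq hin hjk hki hm hrange)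
  · have hcard := ncard_lexsegment hin hjk hki
    have hfin : (lexsegment (edge n 1 i) (edge n 2 k)).Finite :=
      Set.finite_of_ncard_ne_zero (by omega)
    have := hfin.to_subtype
    let e := Finite.equivFin (lexsegment (edge n 1 i) (edge n 2 k))
    have hm : Function.Injective fun a => (e.symm a : Fin n →₀ ℕ) :=
      Subtype.val_injective.comp e.symm.injective
    have hrange : (Set.range fun a => (e.symm a : Fin n →₀ ℕ)) =
        lexsegment (edge n 1 i) (edge n 2 k) := by
      rw [← Function.comp_def, e.symm.surjective.range_comp, Subtype.range_coe]
    exact projectiveDimension_of_taylor _ (lexsegmentEdgeIdeal_eq_span_range hrange)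
      (exists_private_variable_of_range_eq hin hjk hki hm hrange)
  · exact ncard_lexsegment hin hjk hki
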